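/- Let $m\ge 1$ and $n\ge 0$ be integers, $M=m-2n$, and let $\mathcal{O}(\mathbb{R}^{m|2n})=C^\infty(\mathbb{R}^m)\otimes\Lambda_{2n}$, where $\Lambda_{2n}$ is the real Grassmann algebra on generators $\grave{x}_1,\dots,\grave{x}_{2n}$. Write $\mathbf{x}=(x_1,\dots,x_m,\grave{x}_1,\dots,\grave{x}_{2n})$, $\nabla^2_{\mathbf{x}}=\sum_{i=1}^m\partial_{x_i}^2-4\sum_{j=1}^n\partial_{\grave{x}_{2j-1}}\partial_{\grave{x}_{2j}}$, and, for a second supervector $\mathbf{y}$ (whose odd coordinates $\grave{y}_j$ anticommute with each other and with the $\grave{x}_k$), $\theta_y^2=-\sum_{j=1}^n\grave{y}_{2j-1}\grave{y}_{2j}$ and $r=|y|$. The integral over the unit supersphere is $$\int_{\mathbb{S}^{m-1|2n},\mathbf{y}}g=\int_{\mathbb{S}^{m-1}}\int_{B,y}(1-\theta_y^2)^{\frac m2-1}\,\phi^\sharp g,\qquad \phi^\sharp g=\sum_{j=0}^n\frac{(-1)^j\theta_y^{2j}}{j!}\Big(\frac{\partial}{\partial r^2}\Big)^j g,$$ where $\frac{\partial}{\partial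 r^2}=\frac1{2r}\partial_r$, $(1-\theta_y^2)^{m/2-1}$ is the (finite) binomial expansion, $\int_{B,y}=\pi^{-n}\partial_{\grave{y}_{2n}}\cdots\partial_{\grave{y}_1}$, and $\int_{\mathbb{S}^{m-1}}$ is integration with respect to the surface measure of the unit sphere $\mathbb{S}^{m-1}\subset\mathbb{R}^m$. For $f=\sum_A f_A\,\grave{x}_A\in\mathcal{O}(\mathbb{R}^{m|2n})$, put $f(\mathbf{x}+L\mathbf{y})=\sum_A f_A(x+Ly)\,(\grave{x}+L\grave{y})_A$ and define the super basic spherical mean $$Mf(\mathbf{x},L)=\int_{\mathbb{S}^{m-1|2n},\mathbf{y}}f(\mathbf{x}+L\mathbf{y}).$$ Theorem (Darboux). For every $f\in\mathcal{O}(\mathbb{R}^{m|2n})$, $Mf$ belongs to $C^\infty(\mathbb{R}^m\times\mathbb{R})\otimes\Lambda_{2n}$ as a function of $(\mathbf{x},L)$, and for all real $L\ne 0$ $$\Big[\nabla^2_{\mathbf{x}}-\frac{\partial^2}{\partial L^2}-\frac{M-1}{L}\frac{\partial}{\partial L}\Big]Mf(\mathbf{x},L)=0 .$$ -/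

import Mathlib

open scoped ContDiff

noncomputable section

namespace Superspace

/-- The Grassmann algebra `Λ` over `ℝ` on anticommuting generators indexed by `κ`. -/
abbrev Grassmann (κ : Type) : Type := ExteriorAlgebra ℝ (κ → ℝ)

section Grassmann

variable {κ : Type} [Fintype κ] [LinearOrder κ]

/-- The odd generator with index `j`. -/
def gen (j : κ) : Grassmann κ := ExteriorAlgebra.ι ℝ (Pi.basisFun ℝ κ j)

/-- The basis of the Grassmann algebra given by the ordered monomials in the generators. -/
def monomials (κ : Type) [Fintype κ] [LinearOrder κ] :
    Module.Basis (Finset κ) ℝ (Grassmann κ) :=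
  (Pi.basisFun ℝ κ).ExteriorAlgebra

/-- The coefficient `a_A` of the monomial with index `A` in `a = ∑_A a_A θ_A`. -/
def coeff (A : Finset κ) (a : Grassmann κ) : ℝ := (monomials κ).repr a A

/-- The (left) Grassmann derivative with respect to the generator with index `j`: the
antiderivation of the Grassmann algebra that sends the generator `i` to `δ_{ij}`. -/
def oddDeriv (j : κ) : Grassmann κ →ₗ[ℝ] Grassmann κ :=
  CliffordAlgebra.contractLeft (LinearMap.proj j : (κ → ℝ) →ₗ[ℝ] ℝ)

/-- An element `F = ∑_A F_A θ_A` of `C^∞(E) ⊗ Λ`, seen as the `Λ`-valued function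
`p ↦ ∑_A F_A(p) θ_A` on `E`: all coefficients `F_A` are smooth. -/
def IsSuperfunction {E : Type} [NormedAddCommGroup E] [NormedSpace ℝ E]
    (F : E → Grassmann κ) : Prop :=
  ∀ A : Finset κ, ContDiff ℝ ∞ (fun p => coeff A (F p))

/-- The operator `T ⊗ id_Λ`, for `T` an operator on real functions:
`∑_A F_A θ_A ↦ ∑_A T(F_A) θ_A`. -/
def bosonic {E E' : Type} (T : (E → ℝ) → E' → ℝ) (F : E → Grassmann κ) : E' → Grassmann κ :=
  fun p => ∑ A : Finset κ, T (fun q => coeff A (F q)) p • monomials κ A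

end Grassmann

/-- The index of the odd variable `2j-1` for `j = 1, …, n` (counted from zero here). -/
def idxA {n : ℕ} (j : Fin n) : Fin (2 * n) := ⟨2 * (j : ℕ), by omega⟩

/-- The index of the odd variable `2j` for `j = 1, …, n` (counted from zero here). -/
def idxB {n : ℕ} (j : Fin n) : Fin (2 * n) := ⟨2 * (j : ℕ) + 1, by omega⟩

/-- The super Laplace operator
`∇² = ∑_i ∂_{x_i}² - 4 ∑_j ∂_{x̀_{2j-1}} ∂_{x̀_{2j}}` on `ℝ^{m|2n}`. -/
def superLaplacian {m n : ℕ} (F : EuclideanSpace ℝ (Fin m) → Grassmann (Fin (2 * n))) :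
    EuclideanSpace ℝ (Fin m) → Grassmann (Fin (2 * n)) :=
  fun x => bosonic (fun h => Laplacian.laplacian h) F x
    - (4 : ℝ) • ∑ j : Fin n, oddDeriv (idxA j) (oddDeriv (idxB j) (F x))

section Sphere

/- Superfunctions of the supervector `𝐲 ∈ ℝ^{m|2n}` which may also depend on further odd
parameters, indexed by `κ`.  The odd generators are indexed by `κ ⊕ₗ Fin (2 * n)`; those on the
right are the odd coordinates `ỳ_1, …, ỳ_{2n}` of `𝐲`. -/
variable {m n : ℕ} {κ : Type} [Fintype κ] [LinearOrder κ]

/-- `θ_y² = -∑_j ỳ_{2j-1} ỳ_{2j}`. -/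
def thetaSq (κ : Type) [Fintype κ] [LinearOrder κ] (n : ℕ) : Grassmann (κ ⊕ₗ Fin (2 * n)) :=
  -∑ j : Fin n, gen (Sum.inrₗ (idxA j)) * gen (Sum.inrₗ (idxB j))

/-- The Berezin integral `∫_{B,y} = π^{-n} ∂_{ỳ_{2n}} ⋯ ∂_{ỳ_1}`; its value no longer contains
the `ỳ_j` and is read as an element of the Grassmann algebra on the parameters `κ`. -/
def berezin (a : Grassmann (κ ⊕ₗ Fin (2 * n))) : Grassmann κ :=
  (Real.pi ^ n)⁻¹ •
    ExteriorAlgebra.map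
      (LinearMap.funLeft ℝ ℝ (Sum.inlₗ : κ → κ ⊕ₗ Fin (2 * n)))
      ((List.finRange (2 * n)).foldl (fun b j => oddDeriv (Sum.inrₗ j) b) a)

/-- The operator `∂/∂r² = (1/(2r)) ∂_r` on functions on `ℝ^m \ {0}`, where
`r ∂_r = ∑_i y_i ∂_{y_i}`. -/
def radialSqDeriv (h : EuclideanSpace ℝ (Fin m) → ℝ) : EuclideanSpace ℝ (Fin m) → ℝ :=
  fun y => fderiv ℝ h y y / (2 * ‖y‖ ^ 2)

/-- The morphism `φ^♯ = ∑_{j=0}^n ((-1)^j θ_y^{2j} / j!) (∂/∂r²)^j`, the substitution of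
`r² - θ_y²` for `r²`; its value is meaningful on `ℝ^m \ {0}`. -/
def phiSharp (F : EuclideanSpace ℝ (Fin m) → Grassmann (κ ⊕ₗ Fin (2 * n))) :
    EuclideanSpace ℝ (Fin m) → Grassmann (κ ⊕ₗ Fin (2 * n)) :=
  fun y => ∑ j ∈ Finset.range (n + 1),
    ((-1 : ℝ) ^ j / (j.factorial : ℝ)) • (thetaSq κ n ^ j * (bosonic radialSqDeriv)^[j] F y)

/-- `(1 - θ_y²)^s` for real `s`, defined by its finite Taylor expansion
`∑_{j=0}^n (s (s-1) ⋯ (s-j+1) / j!) (-θ_y²)^j`. -/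
def oneSubThetaSqPow (κ : Type) [Fintype κ] [LinearOrder κ] (n : ℕ) (s : ℝ) :
    Grassmann (κ ⊕ₗ Fin (2 * n)) :=
  ∑ j ∈ Finset.range (n + 1),
    ((∏ i ∈ Finset.range j, (s - (i : ℝ))) / (j.factorial : ℝ)) • (-thetaSq κ n) ^ j

/-- The integral over the unit sphere `𝕊^{m-1}` with its surface measure, taken coefficientwise. -/
def sphereIntegral (F : EuclideanSpace ℝ (Fin m) → Grassmann κ) : Grassmann κ :=
  ∑ A : Finset κ,
    (∫ v : Metric.sphere (0 : EuclideanSpace ℝ (Fin m)) 1, coeff A (F v)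
      ∂(MeasureTheory.volume : MeasureTheory.Measure (EuclideanSpace ℝ (Fin m))).toSphere) •
      monomials κ A

/-- The integral over the unit supersphere,
`∫_{𝕊^{m-1|2n}, y} F = ∫_{𝕊^{m-1}} ∫_{B,y} (1 - θ_y²)^{m/2-1} φ^♯ F`. -/
def supersphereIntegral (F : EuclideanSpace ℝ (Fin m) → Grassmann (κ ⊕ₗ Fin (2 * n))) :
    Grassmann κ :=
  sphereIntegral fun y => berezin (oneSubThetaSqPow κ n ((m : ℝ) / 2 - 1) * phiSharp F y)

end Sphere

/-- The linear map on the span of the odd generators corresponding to the substitution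
`x̀_j ↦ x̀_j + L ỳ_j`, with `x̀_j`, `ỳ_j` the generators with index `inl j`, `inr j`. -/
def oddShift (N : ℕ) (L : ℝ) : (Fin N → ℝ) →ₗ[ℝ] (Fin N ⊕ₗ Fin N → ℝ) :=
  LinearMap.pi fun i =>
    Sum.elim (fun j => (LinearMap.proj j : (Fin N → ℝ) →ₗ[ℝ] ℝ)) (fun j => L • LinearMap.proj j)
      (ofLex i)

/-- The superfunction `f(𝐱 + L𝐲) = ∑_A f_A(x + L y) (x̀ + L ỳ)_A` of `𝐲`, with parameters `𝐱`, `L`: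
the algebra morphism `ExteriorAlgebra.map` sends `x̀_j` to `x̀_j + L ỳ_j`. -/
def superShift {m n : ℕ} (f : EuclideanSpace ℝ (Fin m) → Grassmann (Fin (2 * n)))
    (x : EuclideanSpace ℝ (Fin m)) (L : ℝ) :
    EuclideanSpace ℝ (Fin m) → Grassmann (Fin (2 * n) ⊕ₗ Fin (2 * n)) :=
  fun y => ExteriorAlgebra.map (oddShift (2 * n) L) (f (x + L • y))

/-- The super basic spherical mean `Mf(𝐱, L) = ∫_{𝕊^{m-1|2n}, y} f(𝐱 + L𝐲)`. -/
def sphericalMean {m n : ℕ} (f : EuclideanSpace ℝ (Fin m) → Grassmann (Fin (2 * n))) :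
    EuclideanSpace ℝ (Fin m) × ℝ → Grassmann (Fin (2 * n)) :=
  fun p => supersphereIntegral (superShift f p.1 p.2)

/-- The partial derivative `∂/∂L` of a superfunction of `(𝐱, L)`. -/
def derivL {m n : ℕ} (F : EuclideanSpace ℝ (Fin m) × ℝ → Grassmann (Fin (2 * n))) :
    EuclideanSpace ℝ (Fin m) × ℝ → Grassmann (Fin (2 * n)) :=
  bosonic (fun h p => deriv (fun l => h (p.1, l)) p.2) F

end Superspace

end

/-! Write X = (1/2) L ∂_L, s = m/2 - 1, and let N be the odd part of the super Laplacian. The proof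
separates the even from the odd integration and finds a finite expansion of Mf in powers of L² on
which the equation can be checked term by term.

Odd side. The Berezin moments B_k(a) = ∫_B θ^{2k} a(x̀ + Lỳ) satisfy L² B_{k+1}(N a) = -4 (k+1)(n-k)
B_k(a), by integrating by parts twice in each pair of odd variables. The top moment B_n does not
depend on L, since θ^{2n} kills every ỳ_j. Hence B_{n-q}(a) is a constant times L^{2q} B_n(N^q a)
(`berezinMoment_sub`), and B_n N^{n+1} = 0.

Even side. Off the origin (∂/∂r²)^j is r^{-2j} times the j-th falling power of half the Euler
operator in y. On h(x + Ly) that operator acts as X, so after integration over the sphere only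
falling powers of X on the ordinary mean u of h remain. Chu-Vandermonde merges them with the
binomial series of (1 - θ²)^s: the total factor of θ^{2k} is (-1)^k/k! times S_k u, where S_k is the
k-th falling power of s + X. Thus Mf is a sum of terms c_q L^{2q} S_{n-q} u_A ⊗ B_n(N^q x̀_A)
(`sphericalMean_eq_sum_meanTerm`).

Equation. The classical Darboux equation L²Δu = 4X(s + X)u comes from rotation invariance of the
sphere. It propagates to L²Δ S_k u = 4X S_{k+1} u (`shiftedFalling_darboux`). Multiplied by L^{2q},
each term satisfies the wanted equation up to a defect, and this defect is exactly what N
contributes from the term q-1; the chain ends because B_n N^{n+1} = 0 (`sum_meanTerm_darboux`). -/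

noncomputable section

namespace Superspace

set_option linter.unusedSectionVars false

/-! ### Calculus of Grassmann derivatives -/

section Contraction

variable {κ : Type} [Fintype κ] [LinearOrder κ]

/-- The chain rule for odd linear substitutions: both sides obey the same Leibniz rule, so agreement
on generators suffices. -/
theorem contractLeft_exteriorMap {M M' : Type} [AddCommGroup M] [Module ℝ M] [AddCommGroup M']
    [Module ℝ M'] (φ : M →ₗ[ℝ] M') (d : Module.Dual ℝ M') (a : ExteriorAlgebra ℝ M) :
    CliffordAlgebra.contractLeft (Q := (0 : QuadraticForm ℝ M')) d (ExteriorAlgebra.map φ a) =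
      ExteriorAlgebra.map φ
        (CliffordAlgebra.contractLeft (Q := (0 : QuadraticForm ℝ M)) (d ∘ₗ φ) a) := by
  induction a using CliffordAlgebra.left_induction with
  | algebraMap r =>
    rw [AlgHom.commutes]
    erw [CliffordAlgebra.contractLeft_algebraMap, CliffordAlgebra.contractLeft_algebraMap]
    simp
  | add a b ha hb => simp only [map_add, ha, hb]
  | ι_mul a v ha =>
    rw [map_mul]
    erw [ExteriorAlgebra.map_apply_ι]
    erw [CliffordAlgebra.contractLeft_ι_mul, CliffordAlgebra.contractLeft_ι_mul, ha]
    rw [map_sub, map_smul, map_mul]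
    erw [ExteriorAlgebra.map_apply_ι]
    rfl

theorem oddDeriv_oddDeriv_self (j : κ) (a : Grassmann κ) : oddDeriv j (oddDeriv j a) = 0 :=
  CliffordAlgebra.contractLeft_contractLeft _ _

theorem oddDeriv_comm (i j : κ) (a : Grassmann κ) :
    oddDeriv i (oddDeriv j a) = -oddDeriv j (oddDeriv i a) :=
  CliffordAlgebra.contractLeft_comm _ _ _

theorem oddDeriv_gen_mul (i j : κ) (a : Grassmann κ) :
    oddDeriv i (gen j * a) = (if i = j then a else 0) - gen j * oddDeriv i a := by
  refine (CliffordAlgebra.contractLeft_ι_mul _ _ _).trans ?_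
  simp only [LinearMap.proj_apply, Pi.basisFun_apply, Pi.single_apply, ite_smul, one_smul,
    zero_smul, oddDeriv, gen]

/-- Power rule for an element t passing through ∂_j without sign, with c in the role of ∂_j t. -/
theorem oddDeriv_pow_mul {j : κ} {t c : Grassmann κ} (hc : Commute t c)
    (h : ∀ a, oddDeriv j (t * a) = t * oddDeriv j a + c * a) (k : ℕ) (a : Grassmann κ) :
    oddDeriv j (t ^ (k + 1) * a) =
      t ^ (k + 1) * oddDeriv j a + ((k : ℝ) + 1) • (t ^ k * (c * a)) := by
  induction k generalizing a with
  | zero => simp [h]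
  | succ k ih =>
    have h1 : c * (t ^ (k + 1) * a) = t ^ (k + 1) * (c * a) := by
      rw [← mul_assoc, ← (hc.pow_left (k + 1)).eq, mul_assoc]
    have h2 (b : Grassmann κ) (l : ℕ) : t * (t ^ l * b) = t ^ (l + 1) * b := by
      rw [pow_succ', mul_assoc]
    rw [← h2, h, ih, mul_add, mul_smul_comm, h2, h2, h1]
    push_cast
    module

end Contraction

/-! ### Berezin integration and powers of θ² -/

section Berezin

variable {κ : Type} [Fintype κ] [LinearOrder κ] {n : ℕ}

theorem gen_mul_gen_swap (i j : κ) : gen i * gen j = -(gen j * gen i) :=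
  eq_neg_of_add_eq_zero_left (ExteriorAlgebra.ι_add_mul_swap _ _)

theorem gen_mul_self (i : κ) : gen i * gen i = 0 := ExteriorAlgebra.ι_sq_zero _

theorem commute_ι_mul_ι {M : Type} [AddCommGroup M] [Module ℝ M] (u v w : M) :
    Commute (ExteriorAlgebra.ι ℝ u * ExteriorAlgebra.ι ℝ v) (ExteriorAlgebra.ι ℝ w) := by
  have h1 := eq_neg_of_add_eq_zero_left (ExteriorAlgebra.ι_add_mul_swap (R := ℝ) v w)
  have h2 := eq_neg_of_add_eq_zero_left (ExteriorAlgebra.ι_add_mul_swap (R := ℝ) u w)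
  rw [Commute, SemiconjBy, mul_assoc, h1, mul_neg, ← mul_assoc, h2, neg_mul, neg_neg, mul_assoc]

theorem commute_thetaSq_ι (w : κ ⊕ₗ Fin (2 * n) → ℝ) :
    Commute (thetaSq κ n) (ExteriorAlgebra.ι ℝ w) :=
  (Commute.sum_left _ _ _ fun _ _ => commute_ι_mul_ι _ _ _).neg_left

theorem commute_thetaSq_gen (j : κ ⊕ₗ Fin (2 * n)) : Commute (thetaSq κ n) (gen j) :=
  commute_thetaSq_ι _

theorem inrₗ_inj {α β : Type} {i j : β} : (Sum.inrₗ i : α ⊕ₗ β) = Sum.inrₗ j ↔ i = j :=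
  ⟨fun h => Sum.inr_injective (toLex.injective h), fun h => h ▸ rfl⟩

theorem inlₗ_ne_inrₗ {α β : Type} {i : α} {j : β} : (Sum.inlₗ i : α ⊕ₗ β) ≠ Sum.inrₗ j :=
  fun h => Sum.inl_ne_inr (toLex.injective h)

theorem idxA_inj {i j : Fin n} : idxA i = idxA j ↔ i = j := by
  simp [idxA, Fin.ext_iff]

theorem idxB_inj {i j : Fin n} : idxB i = idxB j ↔ i = j := by
  simp [idxB, Fin.ext_iff]

theorem idxA_ne_idxB {i j : Fin n} : idxA i ≠ idxB j := by
  simp only [idxA, idxB, ne_eq, Fin.mk.injEq]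
  omega

theorem exists_idx (i : Fin (2 * n)) : ∃ j : Fin n, i = idxA j ∨ i = idxB j := by
  refine ⟨⟨i / 2, by omega⟩, ?_⟩
  simp only [idxA, idxB, Fin.ext_iff]
  omega

theorem oddDeriv_idxB_thetaSq_mul (j : Fin n) (a : Grassmann (κ ⊕ₗ Fin (2 * n))) :
    oddDeriv (Sum.inrₗ (idxB j)) (thetaSq κ n * a) =
      thetaSq κ n * oddDeriv (Sum.inrₗ (idxB j)) a + gen (Sum.inrₗ (idxA j)) * a := by
  simp only [thetaSq, neg_mul, Finset.sum_mul, map_neg, map_sum, mul_assoc, oddDeriv_gen_mul,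
    inrₗ_inj, idxB_inj, idxA_ne_idxB.symm, if_false, zero_sub, mul_sub, mul_ite, mul_zero,
    Finset.sum_neg_distrib, Finset.sum_sub_distrib, Finset.sum_ite_eq, Finset.mem_univ, if_true]
  abel

theorem oddDeriv_idxA_thetaSq_mul (j : Fin n) (a : Grassmann (κ ⊕ₗ Fin (2 * n))) :
    oddDeriv (Sum.inrₗ (idxA j)) (thetaSq κ n * a) =
      thetaSq κ n * oddDeriv (Sum.inrₗ (idxA j)) a + -gen (Sum.inrₗ (idxB j)) * a := by
  simp only [thetaSq, neg_mul, Finset.sum_mul, map_neg, map_sum, mul_assoc, oddDeriv_gen_mul,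
    inrₗ_inj, idxA_inj, idxA_ne_idxB, if_false, zero_sub, mul_neg, sub_neg_eq_add,
    Finset.sum_add_distrib, Finset.sum_ite_eq, Finset.mem_univ, if_true]
  abel

theorem oddDeriv_inl_thetaSq_mul (j : κ) (a : Grassmann (κ ⊕ₗ Fin (2 * n))) :
    oddDeriv (Sum.inlₗ j) (thetaSq κ n * a) = thetaSq κ n * oddDeriv (Sum.inlₗ j) a := by
  simp only [thetaSq, neg_mul, Finset.sum_mul, map_neg, map_sum, mul_assoc, oddDeriv_gen_mul,
    inlₗ_ne_inrₗ, if_false, zero_sub, mul_neg, neg_neg]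

theorem oddDeriv_inl_thetaSq_pow_mul (j : κ) (k : ℕ) (a : Grassmann (κ ⊕ₗ Fin (2 * n))) :
    oddDeriv (Sum.inlₗ j) (thetaSq κ n ^ k * a) = thetaSq κ n ^ k * oddDeriv (Sum.inlₗ j) a := by
  induction k generalizing a with
  | zero => simp
  | succ k ih => rw [pow_succ, mul_assoc, ih, oddDeriv_inl_thetaSq_mul, mul_assoc]

/-- The iterated left derivative along a list of odd generators, the head of the list first. -/
def iterDeriv : List κ → Grassmann κ →ₗ[ℝ] Grassmann κ
  | [] => LinearMap.id
  | j :: l => iterDeriv l ∘ₗ oddDeriv j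

/-- Anticommutation carries ∂_j, up to sign, to its own copy in the list, and ∂_j² = 0. Hence
Berezin integrals of derivatives vanish. -/
theorem iterDeriv_oddDeriv_of_mem {j : κ} {l : List κ} (h : j ∈ l) (a : Grassmann κ) :
    iterDeriv l (oddDeriv j a) = 0 := by
  induction l generalizing a with
  | nil => simp at h
  | cons i l ih =>
    rw [iterDeriv, LinearMap.comp_apply]
    rcases List.mem_cons.1 h with rfl | h
    · rw [oddDeriv_oddDeriv_self, map_zero]
    · rw [oddDeriv_comm, map_neg, ih h, neg_zero]

theorem iterDeriv_oddDeriv (j : κ) (l : List κ) (a : Grassmann κ) :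
    iterDeriv l (oddDeriv j a) = (-1 : ℝ) ^ l.length • oddDeriv j (iterDeriv l a) := by
  induction l generalizing a with
  | nil => simp [iterDeriv]
  | cons i l ih =>
    rw [iterDeriv, LinearMap.comp_apply, LinearMap.comp_apply, oddDeriv_comm, map_neg, ih,
      List.length_cons, pow_succ, mul_neg_one, neg_smul]

/-- The Berezin integral as a linear map. -/
def berezinLin : Grassmann (κ ⊕ₗ Fin (2 * n)) →ₗ[ℝ] Grassmann κ :=
  (Real.pi ^ n)⁻¹ •
    ((ExteriorAlgebra.map
      (LinearMap.funLeft ℝ ℝ (Sum.inlₗ : κ → κ ⊕ₗ Fin (2 * n)))).toLinearMap ∘ₗ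
      iterDeriv ((List.finRange (2 * n)).map Sum.inrₗ))

theorem iterDeriv_map {ι : Type} (φ : ι → κ) (l : List ι) (a : Grassmann κ) :
    iterDeriv (l.map φ) a = l.foldl (fun b j => oddDeriv (φ j) b) a := by
  induction l generalizing a with
  | nil => rfl
  | cons i l ih => rw [List.map_cons, iterDeriv, LinearMap.comp_apply, ih, List.foldl_cons]

theorem berezin_eq (a : Grassmann (κ ⊕ₗ Fin (2 * n))) : berezin a = berezinLin a := by
  rw [berezin, berezinLin, LinearMap.smul_apply, LinearMap.comp_apply, iterDeriv_map]
  rfl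

theorem berezinLin_oddDeriv_inr (j : Fin (2 * n)) (a : Grassmann (κ ⊕ₗ Fin (2 * n))) :
    berezinLin (oddDeriv (Sum.inrₗ j) a) = 0 := by
  rw [berezinLin, LinearMap.smul_apply, LinearMap.comp_apply, iterDeriv_oddDeriv_of_mem, map_zero,
    smul_zero]
  exact List.mem_map_of_mem (List.mem_finRange j)

/-- No sign appears because a parameter derivative passes an even number, 2n, of derivatives in ỳ.
-/
theorem berezinLin_oddDeriv_inl (j : κ) (a : Grassmann (κ ⊕ₗ Fin (2 * n))) :
    berezinLin (oddDeriv (Sum.inlₗ j) a) = oddDeriv j (berezinLin a) := by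
  have h := contractLeft_exteriorMap
    (LinearMap.funLeft ℝ ℝ (Sum.inlₗ : κ → κ ⊕ₗ Fin (2 * n))) (LinearMap.proj j)
    (iterDeriv ((List.finRange (2 * n)).map Sum.inrₗ) a)
  rw [berezinLin, LinearMap.smul_apply, LinearMap.comp_apply, iterDeriv_oddDeriv,
    List.length_map, List.length_finRange, pow_mul, neg_one_sq, one_pow, one_smul,
    LinearMap.smul_apply, LinearMap.comp_apply, map_smul]
  exact congrArg _ h.symm

/-- Two integrations by parts. At k = 0 the truncated exponent k - 1 is harmless, as its term
carries the factor k. -/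
theorem berezinLin_thetaSq_pow_mul_oddDeriv_oddDeriv (k : ℕ) (j : Fin n)
    (a : Grassmann (κ ⊕ₗ Fin (2 * n))) :
    berezinLin (thetaSq κ n ^ (k + 1) *
        oddDeriv (Sum.inrₗ (idxA j)) (oddDeriv (Sum.inrₗ (idxB j)) a)) =
      ((k : ℝ) + 1) • (berezinLin (thetaSq κ n ^ k * a) +
        (k : ℝ) • berezinLin (thetaSq κ n ^ (k - 1) *
          ((gen (Sum.inrₗ (idxA j)) * gen (Sum.inrₗ (idxB j))) * a))) := by
  set A := gen (Sum.inrₗ (idxA j) : κ ⊕ₗ Fin (2 * n))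
  set B := gen (Sum.inrₗ (idxB j) : κ ⊕ₗ Fin (2 * n)) with hB
  have h1 := oddDeriv_pow_mul (commute_thetaSq_gen _).neg_right
    (oddDeriv_idxA_thetaSq_mul (κ := κ) j) k (oddDeriv (Sum.inrₗ (idxB j)) a)
  have h1' := congrArg berezinLin h1
  rw [berezinLin_oddDeriv_inr, map_add, map_smul, neg_mul, mul_neg, map_neg] at h1'
  have h2 : B * oddDeriv (Sum.inrₗ (idxB j)) a = a - oddDeriv (Sum.inrₗ (idxB j)) (B * a) := by
    rw [hB, oddDeriv_gen_mul, if_pos rfl]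
    abel
  have h3 : berezinLin (thetaSq κ n ^ k * oddDeriv (Sum.inrₗ (idxB j)) (B * a)) =
      -((k : ℝ) • berezinLin (thetaSq κ n ^ (k - 1) * ((A * B) * a))) := by
    rcases k with _ | k
    · simp [berezinLin_oddDeriv_inr]
    · have h4 := oddDeriv_pow_mul (commute_thetaSq_gen _)
        (oddDeriv_idxB_thetaSq_mul (κ := κ) j) k (B * a)
      have h4' := congrArg berezinLin h4
      rw [berezinLin_oddDeriv_inr, map_add, map_smul] at h4'
      rw [Nat.add_sub_cancel, mul_assoc, Nat.cast_succ]
      exact eq_neg_of_add_eq_zero_left h4'.symm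
  rw [← hB, h2, mul_sub, map_sub, h3] at h1'
  rw [← sub_eq_zero, ← h1'.symm.trans rfl]
  module

/-- In n - k, the n counts the pairs, and -k appears because the pair products sum to -θ². -/
theorem berezinLin_thetaSq_pow_mul_sum (k : ℕ) (a : Grassmann (κ ⊕ₗ Fin (2 * n))) :
    berezinLin (thetaSq κ n ^ (k + 1) *
        ∑ j : Fin n, oddDeriv (Sum.inrₗ (idxA j)) (oddDeriv (Sum.inrₗ (idxB j)) a)) =
      (((k : ℝ) + 1) * ((n : ℝ) - k)) • berezinLin (thetaSq κ n ^ k * a) := by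
  rw [Finset.mul_sum, map_sum]
  simp only [berezinLin_thetaSq_pow_mul_oddDeriv_oddDeriv]
  rw [← Finset.smul_sum, Finset.sum_add_distrib, ← Finset.smul_sum, ← map_sum berezinLin (fun j =>
    thetaSq κ n ^ (k - 1) * (gen (Sum.inrₗ (idxA j)) * gen (Sum.inrₗ (idxB j)) * a)),
    ← Finset.mul_sum, ← Finset.sum_mul, show ∑ j : Fin n, gen (Sum.inrₗ (idxA j) : κ ⊕ₗ Fin (2 * n)) *
      gen (Sum.inrₗ (idxB j)) = -thetaSq κ n by rw [thetaSq, neg_neg]]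
  rcases k with _ | k
  · simp [Nat.cast_smul_eq_nsmul]
  · rw [Nat.add_sub_cancel, neg_mul, mul_neg, ← mul_assoc, ← pow_succ, map_neg, Finset.sum_const,
      Finset.card_univ, Fintype.card_fin, ← Nat.cast_smul_eq_nsmul ℝ]
    module

/-- With one more factor than summands, some square-zero summand repeats in every product. -/
theorem sum_pow_succ_card_eq_zero {R ι : Type*} [Ring R] [DecidableEq ι] (s : Finset ι) (t : ι → R)
    (hc : ∀ i j, Commute (t i) (t j)) (ht : ∀ i, t i ^ 2 = 0) :
    (∑ i ∈ s, t i) ^ (s.card + 1) = 0 := by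
  induction s using Finset.induction_on with
  | empty => simp
  | insert i s hi ih =>
    rw [Finset.sum_insert hi, Finset.card_insert_of_notMem hi]
    exact (Commute.sum_right _ _ _ fun j _ => hc i j).add_pow_eq_zero_of_add_le_succ_of_pow_eq_zero
      (ht i) ih (by omega)

theorem commute_pair (i j : Fin n) :
    Commute (gen (Sum.inrₗ (idxA i) : κ ⊕ₗ Fin (2 * n)) * gen (Sum.inrₗ (idxB i)))
      (gen (Sum.inrₗ (idxA j)) * gen (Sum.inrₗ (idxB j))) :=
  (commute_ι_mul_ι _ _ _).mul_right (commute_ι_mul_ι _ _ _)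

theorem pair_sq (i : Fin n) :
    (gen (Sum.inrₗ (idxA i) : κ ⊕ₗ Fin (2 * n)) * gen (Sum.inrₗ (idxB i))) ^ 2 = 0 := by
  have h : Commute (gen (Sum.inrₗ (idxA i) : κ ⊕ₗ Fin (2 * n)) * gen (Sum.inrₗ (idxB i)))
    (gen (Sum.inrₗ (idxA i))) := commute_ι_mul_ι _ _ _
  rw [sq, ← mul_assoc, h.eq, ← mul_assoc, gen_mul_self, zero_mul, zero_mul]

theorem thetaSq_pow_eq_zero {k : ℕ} (hk : n < k) : thetaSq κ n ^ k = 0 := by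
  refine pow_eq_zero_of_le (Nat.succ_le_of_lt hk) ?_
  have h := sum_pow_succ_card_eq_zero (Finset.univ : Finset (Fin n)) _
    (commute_pair (κ := κ)) pair_sq
  rw [Finset.card_univ, Fintype.card_fin] at h
  rw [thetaSq, neg_pow, h, mul_zero]

/-- The generator kills its own pair, so in front of it θ² may be replaced by the sum over the other
n - 1 pairs (up to sign), whose n-th power is zero. -/
theorem thetaSq_pow_mul_gen (i : Fin (2 * n)) :
    thetaSq κ n ^ n * gen (Sum.inrₗ i) = 0 := by
  obtain ⟨j, hj⟩ := exists_idx i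
  set t : Fin n → Grassmann (κ ⊕ₗ Fin (2 * n)) := fun j =>
    gen (Sum.inrₗ (idxA j)) * gen (Sum.inrₗ (idxB j)) with ht
  have h0 : t j * gen (Sum.inrₗ i) = 0 := by
    rcases hj with rfl | rfl
    · rw [ht, mul_assoc, gen_mul_gen_swap (Sum.inrₗ (idxB j)), mul_neg, ← mul_assoc, gen_mul_self,
        zero_mul, neg_zero]
    · rw [ht, mul_assoc, gen_mul_self, mul_zero]
  set S := ∑ l ∈ Finset.univ.erase j, t l with hS
  have hsum : ∑ l, t l = S + t j := (Finset.sum_erase_add _ _ (Finset.mem_univ j)).symm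
  have hcg : ∀ s : Grassmann (κ ⊕ₗ Fin (2 * n)), s = ∑ l, t l → Commute s (gen (Sum.inrₗ i)) := by
    rintro s rfl
    exact Commute.sum_left _ _ _ fun _ _ => commute_ι_mul_ι _ _ _
  have hpow : ∀ k, (∑ l, t l) ^ k * gen (Sum.inrₗ i) = S ^ k * gen (Sum.inrₗ i) := by
    intro k
    induction k with
    | zero => simp
    | succ k ih =>
      rw [pow_succ, mul_assoc, (hcg _ rfl).eq, ← mul_assoc, ih, mul_assoc, ← (hcg _ rfl).eq, hsum,
        add_mul, h0, add_zero, ← mul_assoc, ← pow_succ]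
  have hcard : (Finset.univ.erase j).card + 1 = n := by
    rw [Finset.card_erase_add_one (Finset.mem_univ j), Finset.card_univ, Fintype.card_fin]
  have hz : S ^ n = 0 := by
    have h := sum_pow_succ_card_eq_zero (Finset.univ.erase j) t (commute_pair (κ := κ)) pair_sq
    rwa [hcard] at h
  rw [thetaSq, neg_pow, mul_assoc, hpow, hz, zero_mul, mul_zero]

end Berezin

/-! ### Berezin moments of the odd shift -/

section Shift

variable {n : ℕ}

theorem oddDeriv_inl_map_oddShift (L : ℝ) (j : Fin (2 * n)) (a : Grassmann (Fin (2 * n))) :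
    oddDeriv (Sum.inlₗ j) (ExteriorAlgebra.map (oddShift (2 * n) L) a) =
      ExteriorAlgebra.map (oddShift (2 * n) L) (oddDeriv j a) :=
  contractLeft_exteriorMap (oddShift (2 * n) L) (LinearMap.proj (Sum.inlₗ j)) a

theorem oddDeriv_inr_map_oddShift (L : ℝ) (j : Fin (2 * n)) (a : Grassmann (Fin (2 * n))) :
    oddDeriv (Sum.inrₗ j) (ExteriorAlgebra.map (oddShift (2 * n) L) a) =
      L • ExteriorAlgebra.map (oddShift (2 * n) L) (oddDeriv j a) := by
  refine (contractLeft_exteriorMap (oddShift (2 * n) L) (LinearMap.proj (Sum.inrₗ j)) a).trans ?_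
  rw [show (LinearMap.proj (Sum.inrₗ j) : (Fin (2 * n) ⊕ₗ Fin (2 * n) → ℝ) →ₗ[ℝ] ℝ) ∘ₗ
    oddShift (2 * n) L = L • LinearMap.proj j from rfl, map_smul, LinearMap.smul_apply, map_smul]
  rfl

/-- The odd part `-4 ∑_j ∂_{x̀_{2j-1}} ∂_{x̀_{2j}}` of the super Laplace operator. -/
def oddLaplacian (n : ℕ) : Grassmann (Fin (2 * n)) →ₗ[ℝ] Grassmann (Fin (2 * n)) :=
  (-4 : ℝ) • ∑ j : Fin n, oddDeriv (idxA j) ∘ₗ oddDeriv (idxB j)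

theorem oddLaplacian_apply (a : Grassmann (Fin (2 * n))) :
    oddLaplacian n a = (-4 : ℝ) • ∑ j : Fin n, oddDeriv (idxA j) (oddDeriv (idxB j) a) := by
  simp [oddLaplacian]

/-- `a ↦ ∫_{B,y} θ_y^{2k} a(x̀ + L ỳ)`. -/
def berezinMoment (n k : ℕ) (L : ℝ) : Grassmann (Fin (2 * n)) →ₗ[ℝ] Grassmann (Fin (2 * n)) :=
  berezinLin ∘ₗ LinearMap.mulLeft ℝ (thetaSq (Fin (2 * n)) n ^ k) ∘ₗ
    (ExteriorAlgebra.map (oddShift (2 * n) L)).toLinearMap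

theorem berezinMoment_apply (k : ℕ) (L : ℝ) (a : Grassmann (Fin (2 * n))) :
    berezinMoment n k L a = berezinLin (thetaSq (Fin (2 * n)) n ^ k *
      ExteriorAlgebra.map (oddShift (2 * n) L) a) := rfl

theorem berezinMoment_eq_zero {k : ℕ} (hk : n < k) (L : ℝ) : berezinMoment n k L = 0 := by
  refine LinearMap.ext fun a => ?_
  rw [berezinMoment_apply, thetaSq_pow_eq_zero hk, zero_mul, map_zero, LinearMap.zero_apply]

theorem berezinMoment_oddDeriv (k : ℕ) (L : ℝ) (j : Fin (2 * n)) (a : Grassmann (Fin (2 * n))) :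
    berezinMoment n k L (oddDeriv j a) = oddDeriv j (berezinMoment n k L a) := by
  rw [berezinMoment_apply, berezinMoment_apply, ← berezinLin_oddDeriv_inl,
    oddDeriv_inl_thetaSq_pow_mul, oddDeriv_inl_map_oddShift]

theorem berezinMoment_oddLaplacian (k : ℕ) (L : ℝ) (a : Grassmann (Fin (2 * n))) :
    berezinMoment n k L (oddLaplacian n a) = oddLaplacian n (berezinMoment n k L a) := by
  simp only [oddLaplacian_apply, map_smul, map_sum, berezinMoment_oddDeriv]

/-- On functions of x̀ + Lỳ one has ∂_ỳ = L ∂_x̀; second order gives L². -/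
theorem map_oddShift_oddLaplacian (L : ℝ) (a : Grassmann (Fin (2 * n))) :
    L ^ 2 • ExteriorAlgebra.map (oddShift (2 * n) L) (oddLaplacian n a) =
      (-4 : ℝ) • ∑ j : Fin n, oddDeriv (Sum.inrₗ (idxA j)) (oddDeriv (Sum.inrₗ (idxB j))
        (ExteriorAlgebra.map (oddShift (2 * n) L) a)) := by
  simp only [oddLaplacian_apply, oddDeriv_inr_map_oddShift, map_smul, map_sum, ← Finset.smul_sum]
  module

theorem berezinMoment_succ_oddLaplacian (k : ℕ) (L : ℝ) (a : Grassmann (Fin (2 * n))) :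
    L ^ 2 • berezinMoment n (k + 1) L (oddLaplacian n a) =
      (-4 * (((k : ℝ) + 1) * ((n : ℝ) - k))) • berezinMoment n k L a := by
  rw [berezinMoment_apply, ← map_smul, ← mul_smul_comm, map_oddShift_oddLaplacian, mul_smul_comm,
    map_smul, berezinLin_thetaSq_pow_mul_sum, smul_smul]
  rfl

theorem berezinMoment_zero_oddLaplacian (L : ℝ) (a : Grassmann (Fin (2 * n))) :
    L ^ 2 • berezinMoment n 0 L (oddLaplacian n a) = 0 := by
  rw [berezinMoment_apply, ← map_smul, ← mul_smul_comm, map_oddShift_oddLaplacian, pow_zero,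
    one_mul, map_smul, map_sum]
  simp only [berezinLin_oddDeriv_inr, Finset.sum_const_zero, smul_zero]

/-- The two substitutions differ by a combination of the ỳ_i, which θ^{2n} annihilates. -/
theorem thetaSq_pow_mul_ι_oddShift (L : ℝ) (v : Fin (2 * n) → ℝ) :
    thetaSq (Fin (2 * n)) n ^ n * ExteriorAlgebra.ι ℝ (oddShift (2 * n) L v) =
      thetaSq (Fin (2 * n)) n ^ n * ExteriorAlgebra.ι ℝ (oddShift (2 * n) 0 v) := by
  have h : oddShift (2 * n) L v = oddShift (2 * n) 0 v +
      ∑ i, (L * v i) • Pi.basisFun ℝ (Fin (2 * n) ⊕ₗ Fin (2 * n)) (Sum.inrₗ i) := by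
    ext i
    induction i using Lex.rec with | _ i
    rcases i with i | i
    · simp only [oddShift, Pi.add_apply, Finset.sum_apply, Pi.smul_apply, Pi.basisFun_apply,
        Pi.single_apply]
      rw [Finset.sum_eq_zero fun j _ => ?_, add_zero]
      · rfl
      · rw [if_neg (inlₗ_ne_inrₗ), smul_zero]
    · simp only [Pi.add_apply, Finset.sum_apply, Pi.smul_apply, Pi.basisFun_apply,
        Pi.single_apply]
      rw [Finset.sum_eq_single i]
      · simp [oddShift, Sum.inrₗ]
      · intro j _ hj
        rw [if_neg fun h => hj (inrₗ_inj.1 h).symm, smul_zero]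
      · simp
  rw [h, map_add, mul_add, map_sum, Finset.mul_sum, Finset.sum_eq_zero, add_zero]
  intro i _
  rw [map_smul, mul_smul_comm]
  exact (congrArg _ (thetaSq_pow_mul_gen i)).trans (smul_zero _)

theorem thetaSq_pow_mul_map_oddShift (L : ℝ) (a : Grassmann (Fin (2 * n))) :
    thetaSq (Fin (2 * n)) n ^ n * ExteriorAlgebra.map (oddShift (2 * n) L) a =
      thetaSq (Fin (2 * n)) n ^ n * ExteriorAlgebra.map (oddShift (2 * n) 0) a := by
  induction a using CliffordAlgebra.left_induction with
  | algebraMap r => rw [AlgHom.commutes, AlgHom.commutes]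
  | add a b ha hb => rw [map_add, map_add, mul_add, mul_add, ha, hb]
  | ι_mul a v ha =>
    have hc (l : ℝ) : ExteriorAlgebra.map (oddShift (2 * n) l) (CliffordAlgebra.ι 0 v) =
      ExteriorAlgebra.ι ℝ (oddShift (2 * n) l v) := ExteriorAlgebra.map_apply_ι _ _
    rw [map_mul, map_mul, hc, hc, ← mul_assoc, thetaSq_pow_mul_ι_oddShift,
      ((commute_thetaSq_ι _).pow_left n).eq, mul_assoc, ha, ← mul_assoc,
      ← ((commute_thetaSq_ι _).pow_left n).eq, mul_assoc]

/-- The `L`-independent map `a ↦ ∫_{B,y} θ_y^{2n} a(x̀ + L ỳ)`. -/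
def topMoment (n : ℕ) : Grassmann (Fin (2 * n)) →ₗ[ℝ] Grassmann (Fin (2 * n)) :=
  berezinMoment n n 0

theorem berezinMoment_self (L : ℝ) : berezinMoment n n L = topMoment n := by
  refine LinearMap.ext fun a => ?_
  rw [topMoment, berezinMoment_apply, berezinMoment_apply, thetaSq_pow_mul_map_oddShift]

theorem topMoment_oddLaplacian (a : Grassmann (Fin (2 * n))) :
    topMoment n (oddLaplacian n a) = oddLaplacian n (topMoment n a) :=
  berezinMoment_oddLaplacian _ _ _

/-- Downward recursion from the top moment. Only -4(k+1)(n-k), nonzero for k < n, is inverted, never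
L, so L = 0 is included. -/
theorem berezinMoment_sub {p : ℕ} (hp : p ≤ n) (L : ℝ) (a : Grassmann (Fin (2 * n))) :
    berezinMoment n (n - p) L a =
      ((-1) ^ p * ((n - p).factorial : ℝ) / ((n.factorial : ℝ) * (4 ^ p * p.factorial)) *
        (L ^ 2) ^ p) • topMoment n ((oddLaplacian n ^ p) a) := by
  induction p generalizing a with
  | zero =>
    have : (n.factorial : ℝ) ≠ 0 := by positivity
    simp [berezinMoment_self, this]
  | succ p ih =>
    obtain ⟨k, hk⟩ : ∃ k, n = k + 1 + p := ⟨n - (p + 1), by omega⟩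
    have h := berezinMoment_succ_oddLaplacian (n := n) k L a
    have hnp : n - p = k + 1 := by omega
    have hnp' : n - (p + 1) = k := by omega
    rw [← hnp, ih (by omega)] at h
    have hc : (-4 * (((k : ℝ) + 1) * ((n : ℝ) - k))) ≠ 0 := by
      rw [hk]
      push_cast
      have : (k : ℝ) + 1 + p - k ≠ 0 := by
        have : (0 : ℝ) ≤ p := p.cast_nonneg
        linarith
      have h2 : (k : ℝ) + 1 ≠ 0 := by positivity
      simp [this, h2]
    rw [hnp', ← inv_smul_smul₀ hc (berezinMoment n k L a), ← h, smul_smul, smul_smul,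
      pow_succ (oddLaplacian n), Module.End.mul_apply, hnp]
    congr 1
    have hn : (n : ℝ) = k + 1 + p := by rw [hk]; push_cast; ring
    rw [hn] at hc ⊢
    rw [hk]
    rw [Nat.factorial_succ, Nat.factorial_succ]
    push_cast
    have h1 : (p : ℝ) + 1 ≠ 0 := by positivity
    have h2 : (k : ℝ) + 1 ≠ 0 := by positivity
    have h3 : ((k + 1 + p).factorial : ℝ) ≠ 0 := by positivity
    have h4 : (p.factorial : ℝ) ≠ 0 := by positivity
    have h5 : (k : ℝ) + 1 + p - k = p + 1 := by ring
    rw [h5]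
    field_simp
    ring

/-- The zeroth moment of N a is the Berezin integral of a sum of ỳ-derivatives; at L = 1 it is also
a nonzero multiple of the left side. -/
theorem topMoment_oddLaplacian_pow_succ (a : Grassmann (Fin (2 * n))) :
    topMoment n ((oddLaplacian n ^ (n + 1)) a) = 0 := by
  have h := berezinMoment_zero_oddLaplacian (n := n) 1 a
  have h2 := berezinMoment_sub le_rfl 1 (oddLaplacian n a)
  rw [Nat.sub_self] at h2
  rw [one_pow, one_smul, h2] at h
  rw [pow_succ, Module.End.mul_apply]
  refine (smul_eq_zero.1 h).resolve_left ?_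
  have h3 : (n.factorial : ℝ) ≠ 0 := by positivity
  simp [h3]

end Shift

/-! ### Differentiation under the sphere integral -/

section ParametricIntegral

open MeasureTheory

variable {P E : Type} [NormedAddCommGroup P] [NormedSpace ℝ P] [ProperSpace P]
  [NormedAddCommGroup E] [NormedSpace ℝ E] [ProperSpace E] [MeasurableSpace E] [BorelSpace E]
  (μ : Measure (Metric.sphere (0 : E) 1)) [IsFiniteMeasure μ]

theorem integrable_sphere_of_continuous {G : Type} [NormedAddCommGroup G]
    {H : Metric.sphere (0 : E) 1 → G} (hH : Continuous H) : Integrable H μ :=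
  hH.integrable_of_hasCompactSupport (HasCompactSupport.of_compactSpace H)

theorem hasFDerivAt_sphereAverage {G : Type} [NormedAddCommGroup G] [NormedSpace ℝ G]
    {H : P × E → G} (hH : ContDiff ℝ 1 H) (p : P) :
    HasFDerivAt (fun q => ∫ v : Metric.sphere (0 : E) 1, H (q, v) ∂μ)
      (∫ v : Metric.sphere (0 : E) 1,
        (fderiv ℝ H (p, v)).comp (ContinuousLinearMap.inl ℝ P E) ∂μ) p := by
  have hc : Continuous fun z : P × E =>
      (fderiv ℝ H z).comp (ContinuousLinearMap.inl ℝ P E) :=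
    (hH.continuous_fderiv one_ne_zero).clm_comp continuous_const
  obtain ⟨C, hC⟩ := ((isCompact_closedBall p 1).prod
    (isCompact_sphere (0 : E) 1)).exists_bound_of_continuousOn hc.continuousOn
  have hv (q : P) : Continuous fun v : Metric.sphere (0 : E) 1 => (q, (v : E)) := by fun_prop
  refine hasFDerivAt_integral_of_dominated_of_fderiv_le (μ := μ) (bound := fun _ => C)
    (F' := fun q v => (fderiv ℝ H (q, v)).comp (ContinuousLinearMap.inl ℝ P E))
    (Metric.closedBall_mem_nhds p one_pos) (Filter.Eventually.of_forall fun q => ?_) ?_ ?_ ?_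
    (integrable_const (μ := μ) C) ?_
  · exact (hH.continuous.comp (hv q)).aestronglyMeasurable
  · exact integrable_sphere_of_continuous μ (hH.continuous.comp (hv p))
  · exact (hc.comp (hv p)).aestronglyMeasurable
  · exact Filter.Eventually.of_forall fun v q hq => hC (q, v) ⟨hq, v.2⟩
  · refine Filter.Eventually.of_forall fun v q _ => ?_
    exact ((hH.differentiable one_ne_zero (q, (v : E))).hasFDerivAt).comp q
      (hasFDerivAt_prodMk_left q (v : E))

/-- The derivative is again a sphere average, with values in a space of linear maps; hence the
induction over all targets G. -/
theorem contDiff_nat_sphereAverage (k : ℕ) {G : Type} [NormedAddCommGroup G] [NormedSpace ℝ G]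
    {H : P × E → G} (hH : ContDiff ℝ ∞ H) :
    ContDiff ℝ k fun q => ∫ v : Metric.sphere (0 : E) 1, H (q, v) ∂μ := by
  induction k generalizing G with
  | zero =>
    exact contDiff_zero.2 (continuous_iff_continuousAt.2 fun p =>
      (hasFDerivAt_sphereAverage μ (hH.of_le (by simp)) p).continuousAt)
  | succ k ih =>
    have hd := fun p => hasFDerivAt_sphereAverage μ (hH.of_le (by simp)) p
    rw [Nat.cast_succ, contDiff_succ_iff_fderiv]
    refine ⟨fun p => (hd p).differentiableAt, by simp, ?_⟩
    rw [funext fun p => (hd p).fderiv]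
    refine ih (H := fun z => (fderiv ℝ H z).comp (ContinuousLinearMap.inl ℝ P E)) ?_
    exact (hH.fderiv_right (by simp)).clm_comp contDiff_const

theorem contDiff_sphereAverage {G : Type} [NormedAddCommGroup G] [NormedSpace ℝ G]
    {H : P × E → G} (hH : ContDiff ℝ ∞ H) :
    ContDiff ℝ ∞ fun q => ∫ v : Metric.sphere (0 : E) 1, H (q, v) ∂μ :=
  contDiff_infty.2 fun k => contDiff_nat_sphereAverage μ k hH

theorem fderiv_sphereAverage_apply {H : P × E → ℝ} (hH : ContDiff ℝ ∞ H) (p w : P) :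
    fderiv ℝ (fun q => ∫ v : Metric.sphere (0 : E) 1, H (q, v) ∂μ) p w =
      ∫ v : Metric.sphere (0 : E) 1, fderiv ℝ H (p, v) (w, 0) ∂μ := by
  have hH1 : ContDiff ℝ 1 H := hH.of_le (by simp)
  rw [(hasFDerivAt_sphereAverage μ hH1 p).fderiv, ContinuousLinearMap.integral_apply]
  · rfl
  · refine integrable_sphere_of_continuous μ ?_
    exact ((hH1.continuous_fderiv one_ne_zero).comp (by fun_prop)).clm_comp continuous_const

end ParametricIntegral

/-! ### Rotation invariance of the surface measure -/

section Rotation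

open MeasureTheory
open scoped Pointwise

variable {E : Type} [NormedAddCommGroup E] [InnerProductSpace ℝ E] [FiniteDimensional ℝ E]
  [MeasurableSpace E] [BorelSpace E]

/-- The surface measure is defined by the volume of cones over the set; a linear isometry preserves
volume and maps cones to cones. -/
theorem integral_toSphere_comp_isometry (U : E ≃ₗᵢ[ℝ] E) (g : E → ℝ) :
    ∫ v : Metric.sphere (0 : E) 1, g (U v) ∂(volume : Measure E).toSphere =
      ∫ v : Metric.sphere (0 : E) 1, g v ∂(volume : Measure E).toSphere := by
  let e : Metric.sphere (0 : E) 1 ≃ₜ Metric.sphere (0 : E) 1 :=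
    U.toHomeomorph.subtype fun x => by simp
  have he : MeasurePreserving e (volume : Measure E).toSphere (volume : Measure E).toSphere := by
    refine ⟨e.measurable, Measure.ext fun s hs => ?_⟩
    rw [Measure.map_apply e.measurable hs, Measure.toSphere_apply' _ hs,
      Measure.toSphere_apply' _ (e.measurable hs)]
    have h : Set.Ioo (0 : ℝ) 1 • ((↑) '' (e ⁻¹' s) : Set E) =
        U ⁻¹' (Set.Ioo (0 : ℝ) 1 • ((↑) '' s)) := by
      ext x
      simp only [Set.mem_smul, Set.mem_image, Set.mem_preimage]
      constructor
      · rintro ⟨r, hr, _, ⟨y, hy, rfl⟩, rfl⟩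
        exact ⟨r, hr, _, ⟨e y, hy, rfl⟩, (map_smul U r (y : E)).symm⟩
      · rintro ⟨r, hr, _, ⟨y, hy, rfl⟩, hx⟩
        refine ⟨r, hr, _, ⟨e.symm y, by simpa using hy, rfl⟩, U.injective ?_⟩
        rw [map_smul, ← hx]
        congr 1
        exact U.apply_symm_apply y
    rw [h]
    exact congrArg _ (U.measurePreserving.measure_preimage_equiv (f := U.toMeasurableEquiv) _)
  exact he.integral_comp e.measurableEmbedding (fun v => g v)

/-- Integration over the unit sphere kills the derivative along the rotation generator in the
plane of two orthonormal vectors. -/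
theorem integral_toSphere_rotation {e₁ e₂ : E} (h₁ : ‖e₁‖ = 1) (h₂ : ‖e₂‖ = 1)
    (h₁₂ : inner ℝ e₁ e₂ = 0) {g : E → ℝ} (hg : ContDiff ℝ ∞ g) :
    ∫ v : Metric.sphere (0 : E) 1, fderiv ℝ g v (inner ℝ e₁ (v : E) • e₂ - inner ℝ e₂ (v : E) • e₁)
      ∂(volume : Measure E).toSphere = 0 := by
  let w : ℝ → E := fun t => Real.cos t • e₁ + Real.sin t • e₂
  have hw (t : ℝ) : ‖w t‖ = 1 := by
    have : ‖w t‖ ^ 2 = 1 := by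
      rw [norm_add_sq_real, norm_smul, norm_smul, inner_smul_left, inner_smul_right, h₁₂, h₁, h₂,
        mul_one, mul_one, Real.norm_eq_abs, Real.norm_eq_abs, sq_abs, sq_abs]
      simp
    exact (pow_eq_one_iff_of_nonneg (norm_nonneg _) two_ne_zero).1 this
  -- The smooth family of reflections fixing the line of w(t) replaces a one-parameter group of
  -- rotations; its velocity at t = 0 is twice the rotation field, evaluated at ρ(0, y).
  let ρ : ℝ × E → E := fun z => (2 * inner ℝ (w z.1) z.2) • w z.1 - z.2
  have hws : ContDiff ℝ ∞ w := by
    exact (Real.contDiff_cos.smul contDiff_const).add (Real.contDiff_sin.smul contDiff_const)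
  have hρ : ContDiff ℝ ∞ ρ :=
    ((contDiff_const.mul ((hws.comp contDiff_fst).inner ℝ contDiff_snd)).smul
      (hws.comp contDiff_fst)).sub contDiff_snd
  have hρ' (t : ℝ) (y : E) : ρ (t, y) = (Submodule.span ℝ {w t}).reflection y := by
    rw [Submodule.reflection_singleton_apply, hw]
    simp [ρ, two_smul, two_mul, add_smul]
  have hconst (t : ℝ) : ∫ v : Metric.sphere (0 : E) 1, g (ρ (t, v)) ∂(volume : Measure E).toSphere =
      ∫ v : Metric.sphere (0 : E) 1, g v ∂(volume : Measure E).toSphere := by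
    simp only [hρ']
    exact integral_toSphere_comp_isometry _ g
  have hd := fderiv_sphereAverage_apply (volume : Measure E).toSphere (hg.comp hρ) 0 (1 : ℝ)
  simp only [Function.comp_apply, hconst, fderiv_fun_const, Pi.zero_apply,
    zero_apply] at hd
  let φ : E → ℝ := fun z => fderiv ℝ g z (inner ℝ e₁ z • e₂ - inner ℝ e₂ z • e₁)
  have hder (y : E) : fderiv ℝ (g ∘ ρ) (0, y) (1, 0) = 2 * φ (ρ (0, y)) := by
    have hw' : HasDerivAt w e₂ 0 := by
      have h := ((Real.hasDerivAt_cos 0).smul_const e₁).add ((Real.hasDerivAt_sin 0).smul_const e₂)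
      rw [Real.sin_zero, Real.cos_zero, neg_zero, zero_smul, one_smul, zero_add] at h
      exact h
    have hcurve : HasDerivAt (fun t => ρ (t, y))
        ((2 * inner ℝ e₁ y) • e₂ + (2 * inner ℝ e₂ y) • e₁) 0 := by
      have h := (((hw'.inner ℝ (hasDerivAt_const 0 y)).const_mul 2).smul hw').sub_const y
      simpa [w, ρ] using h
    have h1 : HasDerivAt (fun t => ρ (t, y)) (fderiv ℝ ρ (0, y) (1, 0)) 0 :=
      HasFDerivAt.comp_hasDerivAt (f := fun t : ℝ => (t, y)) (0 : ℝ)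
        (hρ.differentiable (by simp) (0, y)).hasFDerivAt ((hasDerivAt_id (0 : ℝ)).prodMk (hasDerivAt_const 0 y))
    rw [fderiv_comp _ (hg.differentiable (by simp) _) (hρ.differentiable (by simp) _),
      ContinuousLinearMap.comp_apply, h1.unique hcurve]
    have hρ0 : ρ (0, y) = (2 * inner ℝ e₁ y) • e₁ - y := by simp [ρ, w]
    have h21 : inner ℝ e₂ e₁ = 0 := by rw [real_inner_comm, h₁₂]
    have i1 : inner ℝ e₁ (ρ (0, y)) = inner ℝ e₁ y := by
      rw [hρ0, inner_sub_right, inner_smul_right, real_inner_self_eq_norm_sq, h₁]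
      ring
    have i2 : inner ℝ e₂ (ρ (0, y)) = -inner ℝ e₂ y := by
      rw [hρ0, inner_sub_right, inner_smul_right, h21]
      ring
    change _ = (2 : ℝ) • fderiv ℝ g (ρ (0, y)) _
    rw [← map_smul, i1, i2]
    congr 1
    module
  simp only [hder, integral_const_mul] at hd
  have h0 : ∫ v : Metric.sphere (0 : E) 1, φ (ρ (0, v)) ∂(volume : Measure E).toSphere = 0 := by
    linarith
  -- The remaining ρ(0, ·) is itself an isometry and drops out of the integral.
  simp only [hρ'] at h0
  rwa [integral_toSphere_comp_isometry _ φ] at h0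

end Rotation

/-! ### Smooth functions as a module, with differential operators in its endomorphism ring -/

section SmoothFun

variable {V : Type} [NormedAddCommGroup V] [NormedSpace ℝ V]

/-- The real vector space of smooth real functions on `V`, as a submodule. -/
def smoothSubmodule (V : Type) [NormedAddCommGroup V] [NormedSpace ℝ V] :
    Submodule ℝ (V → ℝ) where
  carrier := {h | ContDiff ℝ ∞ h}
  add_mem' := fun {_ _} (h₁ : ContDiff ℝ ∞ _) h₂ => h₁.add h₂
  zero_mem' := (contDiff_const : ContDiff ℝ ∞ fun _ : V => (0 : ℝ))
  smul_mem' := fun _ _ (h : ContDiff ℝ ∞ _) => contDiff_const.smul h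

/-- The type of smooth real functions on `V`. -/
def SmoothFun (V : Type) [NormedAddCommGroup V] [NormedSpace ℝ V] : Type := smoothSubmodule V

instance : AddCommGroup (SmoothFun V) := inferInstanceAs (AddCommGroup (smoothSubmodule V))

instance : Module ℝ (SmoothFun V) := inferInstanceAs (Module ℝ (smoothSubmodule V))

/-- The function underlying a smooth function. -/
def SmoothFun.toFun (s : SmoothFun V) : V → ℝ := s.1

instance : CoeFun (SmoothFun V) fun _ => V → ℝ := ⟨SmoothFun.toFun⟩

theorem SmoothFun.contDiff (s : SmoothFun V) : ContDiff ℝ ∞ (s : V → ℝ) := s.2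

theorem SmoothFun.differentiable (s : SmoothFun V) : Differentiable ℝ (s : V → ℝ) :=
  s.contDiff.differentiable (by simp)

theorem SmoothFun.ext {s t : SmoothFun V} (h : ∀ p, s p = t p) : s = t :=
  Subtype.ext (funext h)

/-- Evaluation of smooth functions at a point. -/
def SmoothFun.eval (p : V) : SmoothFun V →ₗ[ℝ] ℝ where
  toFun s := s p
  map_add' _ _ := rfl
  map_smul' _ _ := rfl

theorem SmoothFun.sum_apply {ι : Type*} (I : Finset ι) (s : ι → SmoothFun V) (p : V) :
    (∑ i ∈ I, s i) p = ∑ i ∈ I, s i p := map_sum (SmoothFun.eval p) s I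

/-- The derivative of smooth functions in a fixed direction. -/
def dirDeriv (v : V) : Module.End ℝ (SmoothFun V) where
  toFun s := ⟨fun p => fderiv ℝ s p v,
    (s.contDiff.fderiv_right (m := ∞) (by simp)).clm_apply contDiff_const⟩
  map_add' s t := SmoothFun.ext fun p => by
    change fderiv ℝ ((s : V → ℝ) + (t : V → ℝ)) p v = _
    rw [fderiv_add (s.differentiable p) (t.differentiable p)]
    rfl
  map_smul' c s := SmoothFun.ext fun p => by
    change fderiv ℝ (c • (s : V → ℝ)) p v = _
    rw [fderiv_const_smul (s.differentiable p)]
    rfl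

theorem dirDeriv_comm (v w : V) : dirDeriv v * dirDeriv w = dirDeriv w * dirDeriv v := by
  refine LinearMap.ext fun s => SmoothFun.ext fun p => ?_
  have hd : DifferentiableAt ℝ (fderiv ℝ (s : V → ℝ)) p :=
    (s.contDiff.fderiv_right (m := ∞) (by simp)).differentiable (by simp) p
  have h (v w : V) : ((dirDeriv v * dirDeriv w) s : V → ℝ) p =
      fderiv ℝ (fderiv ℝ (s : V → ℝ)) p v w := by
    change fderiv ℝ (fun q => fderiv ℝ s q w) p v = _
    rw [fderiv_clm_apply hd (differentiableAt_const w)]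
    simp
  rw [h, h]
  exact (s.contDiff.contDiffAt.isSymmSndFDerivAt
    (by
      rw [minSmoothness_of_isRCLikeNormedField]
      exact WithTop.coe_le_coe.2 (le_top : (2 : ℕ∞) ≤ ⊤))).eq v w

/-- Multiplication of smooth functions by a continuous linear functional. -/
def mulFunctional (l : V →L[ℝ] ℝ) : Module.End ℝ (SmoothFun V) where
  toFun s := ⟨fun p => l p * s p, l.contDiff.mul s.contDiff⟩
  map_add' s t := SmoothFun.ext fun p => mul_add _ _ _
  map_smul' c s := SmoothFun.ext fun p => by
    change l p * (c * s p) = c * (l p * s p)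
    ring

theorem mulFunctional_apply (l : V →L[ℝ] ℝ) (s : SmoothFun V) (p : V) :
    mulFunctional l s p = l p * s p := rfl

theorem mulFunctional_comm (l l' : V →L[ℝ] ℝ) :
    mulFunctional l * mulFunctional l' = mulFunctional l' * mulFunctional l :=
  LinearMap.ext fun s => SmoothFun.ext fun p => by
    change l p * (l' p * s p) = l' p * (l p * s p)
    ring

theorem dirDeriv_mul_mulFunctional (v : V) (l : V →L[ℝ] ℝ) :
    dirDeriv v * mulFunctional l = mulFunctional l * dirDeriv v + l v • 1 :=
  LinearMap.ext fun s => SmoothFun.ext fun p => by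
    change fderiv ℝ (fun q => l q * s q) p v =
      l p * fderiv ℝ s p v + l v * s p
    rw [fderiv_fun_mul l.differentiableAt (s.differentiable p)]
    simp [mul_comm]

theorem commute_dirDeriv_mulFunctional {v : V} {l : V →L[ℝ] ℝ} (h : l v = 0) :
    Commute (dirDeriv v) (mulFunctional l) := by
  rw [Commute, SemiconjBy, dirDeriv_mul_mulFunctional, h, zero_smul, add_zero]

end SmoothFun

/-! ### Falling powers in a ring -/

section FallingPower

variable {R : Type*} [Ring R]

/-- The falling power `X (X - 1) ⋯ (X - k + 1)`. -/
def fallingPow (k : ℕ) (X : R) : R := (descPochhammer ℤ k).smeval X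

theorem fallingPow_zero (X : R) : fallingPow 0 X = 1 := by
  simp [fallingPow]

theorem fallingPow_succ (k : ℕ) (X : R) :
    fallingPow (k + 1) X = (X - k) * fallingPow k X := by
  rw [fallingPow, descPochhammer_succ_right, mul_comm, Polynomial.smeval_mul,
    Polynomial.smeval_sub, Polynomial.smeval_X, Polynomial.smeval_natCast, pow_zero, pow_one,
    nsmul_one, fallingPow]

theorem commute_fallingPow {X Z : R} (h : Commute Z X) (k : ℕ) : Commute Z (fallingPow k X) := by
  induction k with
  | zero => rw [fallingPow_zero]; exact Commute.one_right _
  | succ k ih =>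
    rw [fallingPow_succ]
    exact (h.sub_right (Nat.commute_cast Z k)).mul_right ih

/-- The Chu-Vandermonde identity. -/
theorem fallingPow_add {X Z : R} (k : ℕ) (h : Commute X Z) :
    fallingPow k (X + Z) = ∑ ij ∈ Finset.HasAntidiagonal.antidiagonal k,
      (k.choose ij.1 : R) * (fallingPow ij.1 X * fallingPow ij.2 Z) :=
  Ring.descPochhammer_smeval_add k h

theorem fallingPow_algebraMap [Algebra ℝ R] (k : ℕ) (a : ℝ) :
    fallingPow k (algebraMap ℝ R a) = algebraMap ℝ R (∏ i ∈ Finset.range k, (a - i)) := by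
  induction k with
  | zero => simp [fallingPow_zero]
  | succ k ih => rw [fallingPow_succ, ih, Finset.prod_range_succ, mul_comm (Finset.prod _ _)]; simp

end FallingPower

/-! ### Sphere averages and the Euler operator -/

section SphericalMeans

open MeasureTheory

variable {m : ℕ}

/-- The Euclidean space `ℝ^m`. -/
abbrev Euc (m : ℕ) : Type := EuclideanSpace ℝ (Fin m)

/-- The standard basis vectors. -/
def stdVec (i : Fin m) : EuclideanSpace ℝ (Fin m) := EuclideanSpace.basisFun (Fin m) ℝ i

/-- The coordinate functionals. -/
def coord (i : Fin m) : EuclideanSpace ℝ (Fin m) →L[ℝ] ℝ := EuclideanSpace.proj i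

theorem coord_stdVec (i j : Fin m) : coord i (stdVec j) = if i = j then 1 else 0 := by
  simp [coord, stdVec]

theorem coord_eq_inner (i : Fin m) (y : Euc m) : coord i y = inner ℝ (stdVec i) y := by
  simp [coord, stdVec, EuclideanSpace.inner_single_left]

theorem sum_coord_smul_stdVec (y : Euc m) : ∑ i, coord i y • stdVec i = y := by
  have := (EuclideanSpace.basisFun (Fin m) ℝ).sum_repr y
  simpa [coord, stdVec] using this

theorem sum_coord_sq (y : Euc m) : ∑ i, coord i y * coord i y = ‖y‖ ^ 2 := by
  rw [EuclideanSpace.norm_sq_eq]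
  simp [coord, sq]

/-- The average over the unit sphere in the last variable. -/
def sphereAverage : SmoothFun ((Euc m × ℝ) × Euc m) →ₗ[ℝ] SmoothFun (Euc m × ℝ) where
  toFun H := ⟨fun p => ∫ v : Metric.sphere (0 : Euc m) 1, H (p, v)
    ∂(volume : Measure (Euc m)).toSphere, contDiff_sphereAverage _ H.contDiff⟩
  map_add' H K := SmoothFun.ext fun p => by
    refine integral_add ?_ ?_
    · exact integrable_sphere_of_continuous _ (H.contDiff.continuous.comp (by fun_prop))
    · exact integrable_sphere_of_continuous _ (K.contDiff.continuous.comp (by fun_prop))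
  map_smul' c H := SmoothFun.ext fun p => integral_const_mul c _

theorem sphereAverage_apply (H : SmoothFun ((Euc m × ℝ) × Euc m)) (p : Euc m × ℝ) :
    sphereAverage H p = ∫ v : Metric.sphere (0 : Euc m) 1,
      H (p, v) ∂(volume : Measure (Euc m)).toSphere := rfl

theorem sphereAverage_dirDeriv (w : Euc m × ℝ) (H : SmoothFun ((Euc m × ℝ) × Euc m)) :
    sphereAverage (dirDeriv (w, 0) H) = dirDeriv w (sphereAverage H) :=
  SmoothFun.ext fun p => (fderiv_sphereAverage_apply _ H.contDiff p w).symm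

theorem sphereAverage_mulFunctional (l : Euc m × ℝ →L[ℝ] ℝ) (H : SmoothFun ((Euc m × ℝ) × Euc m)) :
    sphereAverage (mulFunctional (l.comp (ContinuousLinearMap.fst ℝ _ _)) H) =
      mulFunctional l (sphereAverage H) :=
  SmoothFun.ext fun p => integral_const_mul (l p) _

/-- Multiplication by the coordinate `y_i`. -/
def mulY (i : Fin m) : Module.End ℝ (SmoothFun ((Euc m × ℝ) × Euc m)) :=
  mulFunctional ((coord i).comp (ContinuousLinearMap.snd ℝ _ _))

/-- The partial derivative `∂/∂y_i`. -/
def derivY (i : Fin m) : Module.End ℝ (SmoothFun ((Euc m × ℝ) × Euc m)) := dirDeriv (0, stdVec i)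

/-- The Euler operator `∑_i y_i ∂/∂y_i`. -/
def eulerY (m : ℕ) : Module.End ℝ (SmoothFun ((Euc m × ℝ) × Euc m)) := ∑ i, mulY i * derivY i

theorem derivY_mul_mulY (i j : Fin m) :
    derivY j * mulY i = mulY i * derivY j + if i = j then 1 else 0 := by
  rw [derivY, mulY, dirDeriv_mul_mulFunctional]
  simp only [ContinuousLinearMap.comp_apply, ContinuousLinearMap.coe_snd', coord_stdVec, ite_smul,
    one_smul, zero_smul]

theorem sphereAverage_mulY_mul_mulY (H : SmoothFun ((Euc m × ℝ) × Euc m)) :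
    sphereAverage ((∑ i, mulY i * mulY i) H) = sphereAverage H := by
  refine SmoothFun.ext fun p => ?_
  rw [sphereAverage_apply, sphereAverage_apply]
  refine integral_congr_ae (Filter.Eventually.of_forall fun v => ?_)
  have h : ∑ i, coord i (v : Euc m) * (coord i (v : Euc m) * H (p, v)) =
      H (p, v) := by
    simp only [← mul_assoc]
    rw [← Finset.sum_mul, sum_coord_sq, norm_eq_of_mem_sphere, one_pow, one_mul]
  change ((∑ i, mulY i * mulY i : Module.End ℝ (SmoothFun ((Euc m × ℝ) × Euc m))) H :
    (Euc m × ℝ) × Euc m → ℝ) (p, v) = _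
  rw [LinearMap.sum_apply, SmoothFun.sum_apply]
  exact h

theorem sphereAverage_rotation (i j : Fin m) (H : SmoothFun ((Euc m × ℝ) × Euc m)) :
    sphereAverage ((mulY i * derivY j - mulY j * derivY i) H) = 0 := by
  rcases eq_or_ne i j with rfl | hij
  · simp
  refine SmoothFun.ext fun p => ?_
  let g : Euc m → ℝ := fun y => H (p, y)
  have hg : ContDiff ℝ ∞ g := H.contDiff.comp (contDiff_const.prodMk contDiff_id)
  have hn (k : Fin m) : ‖stdVec k‖ = 1 := (EuclideanSpace.basisFun (Fin m) ℝ).norm_eq_one k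
  have h := integral_toSphere_rotation (hn i) (hn j)
    ((EuclideanSpace.basisFun (Fin m) ℝ).inner_eq_zero hij) hg
  refine Eq.trans (integral_congr_ae (Filter.Eventually.of_forall fun v => ?_)) h
  have hd : HasFDerivAt g ((fderiv ℝ H (p, v)).comp
      (ContinuousLinearMap.inr ℝ _ _)) v :=
    (H.differentiable (p, (v : Euc m))).hasFDerivAt.comp (v : Euc m) (hasFDerivAt_prodMk_right p (v : Euc m))
  change coord i (v : Euc m) * fderiv ℝ H (p, v) (0, stdVec j) -
    coord j (v : Euc m) * fderiv ℝ H (p, v) (0, stdVec i) = fderiv ℝ g v _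
  rw [hd.fderiv, ← coord_eq_inner, ← coord_eq_inner, map_sub, map_smul, map_smul]
  rfl

/-- Half the Casimir of the rotation algebra, arranged with a rotation field leftmost in each
summand so that sphere averages vanish. -/
theorem sum_rotation_mul (m : ℕ) :
    ∑ i : Fin m, ∑ j, (mulY i * derivY j - mulY j * derivY i) * (mulY i * derivY j) =
      (∑ i, mulY i * mulY i) * (∑ j : Fin m, derivY j * derivY j) -
        eulerY m * (eulerY m + ((m : ℝ) - 2) • 1) := by
  have hyd (i j : Fin m) (T : Module.End ℝ (SmoothFun ((Euc m × ℝ) × Euc m))) :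
      derivY j * (mulY i * T) = mulY i * (derivY j * T) + if i = j then T else 0 := by
    rw [← mul_assoc, derivY_mul_mulY, add_mul, mul_assoc]
    split_ifs <;> simp
  have h1 (i j : Fin m) : (mulY i * derivY j - mulY j * derivY i) * (mulY i * derivY j) =
      mulY i * (mulY i * (derivY j * derivY j)) + (if i = j then mulY i * derivY j else 0)
        - mulY i * (mulY j * (derivY i * derivY j)) - mulY j * derivY j := by
    rw [sub_mul, mul_assoc, mul_assoc, hyd, hyd, if_pos rfl, mul_add, mul_add, mul_ite, mul_zero,
      ← mul_assoc (mulY j) (mulY i), mulY, mulY, mulFunctional_comm]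
    simp only [mul_assoc]
    abel
  have h2 : eulerY m * eulerY m = (∑ i, ∑ j, mulY i * (mulY j * (derivY i * derivY j))) +
      eulerY m := by
    simp only [eulerY, Finset.sum_mul_sum, mul_assoc, hyd, mul_add, mul_ite, mul_zero,
      Finset.sum_add_distrib, Finset.sum_ite_eq', Finset.mem_univ, if_true]
  simp only [h1, Finset.sum_sub_distrib, Finset.sum_add_distrib, Finset.sum_ite_eq,
    Finset.mem_univ, if_true, Finset.sum_const, Finset.card_univ, Fintype.card_fin]
  rw [mul_add, h2, Finset.sum_mul_sum]
  rw [eulerY]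
  simp only [mul_assoc, mul_smul_comm, mul_one, ← Nat.cast_smul_eq_nsmul ℝ]
  module

theorem sphereAverage_euler (H : SmoothFun ((Euc m × ℝ) × Euc m)) :
    sphereAverage ((∑ j : Fin m, derivY j * derivY j) H) =
      sphereAverage ((eulerY m * (eulerY m + ((m : ℝ) - 2) • 1)) H) := by
  rw [← sub_eq_zero, ← sphereAverage_mulY_mul_mulY, ← Module.End.mul_apply, ← map_sub,
    ← LinearMap.sub_apply, ← sum_rotation_mul]
  simp only [LinearMap.sum_apply, map_sum, Module.End.mul_apply]
  exact Finset.sum_eq_zero fun i _ => Finset.sum_eq_zero fun j _ => sphereAverage_rotation i j _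

end SphericalMeans

/-! ### The classical Darboux equation and its falling-power version -/

section Darboux

variable {m : ℕ}

theorem fallingPow_intertwine {V W : Type*} [AddCommGroup V] [Module ℝ V] [AddCommGroup W]
    [Module ℝ W] (T : V →ₗ[ℝ] W) {A : Module.End ℝ V} {B : Module.End ℝ W}
    (h : ∀ s, T (A s) = B (T s)) (k : ℕ) (s : V) :
    T (fallingPow k A s) = fallingPow k B (T s) := by
  induction k with
  | zero => simp [fallingPow_zero]
  | succ k ih =>
    simp only [fallingPow_succ, Module.End.mul_apply, LinearMap.sub_apply, map_sub, h, ih,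
      Module.End.natCast_apply, map_nsmul]

/-- Agreement at the single vector s suffices, since commutation lets each new factor act on s
first. Needed because the Euler operators in y and in L agree on h(x + Ly) only. -/
theorem fallingPow_apply_congr {V : Type*} [AddCommGroup V] [Module ℝ V] {A B : Module.End ℝ V}
    (hc : Commute A B) {s : V} (h : A s = B s) (k : ℕ) :
    fallingPow k A s = fallingPow k B s := by
  induction k with
  | zero => simp [fallingPow_zero]
  | succ k ih =>
    have h1 : Commute (A - k) (fallingPow k B) :=
      (commute_fallingPow hc k).sub_left (Nat.cast_commute k _)
    have h2 : Commute (B - k) (fallingPow k B) :=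
      (commute_fallingPow (Commute.refl B) k).sub_left (Nat.cast_commute k _)
    rw [fallingPow_succ, fallingPow_succ, h2.eq, Module.End.mul_apply, ih, ← Module.End.mul_apply,
      h1.eq, Module.End.mul_apply, Module.End.mul_apply, LinearMap.sub_apply, LinearMap.sub_apply,
      h]

/-- Multiplication by `L`. -/
def mulL (m : ℕ) : Module.End ℝ (SmoothFun (Euc m × ℝ)) :=
  mulFunctional (ContinuousLinearMap.snd ℝ _ _)

/-- The operator `(1/2) L ∂/∂L`. -/
def halfEuler (m : ℕ) : Module.End ℝ (SmoothFun (Euc m × ℝ)) :=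
  (1 / 2 : ℝ) • (mulL m * dirDeriv (0, 1))

/-- Multiplication by `L²`. -/
def mulLSq (m : ℕ) : Module.End ℝ (SmoothFun (Euc m × ℝ)) := mulL m * mulL m

/-- The Laplace operator in the even variables of `𝐱`. -/
def evenLaplacian (m : ℕ) : Module.End ℝ (SmoothFun (Euc m × ℝ)) :=
  ∑ i : Fin m, dirDeriv (stdVec i, 0) * dirDeriv (stdVec i, 0)

theorem commute_dirDeriv_mulL (v : Euc m) : Commute (dirDeriv (v, (0 : ℝ))) (mulL m) :=
  commute_dirDeriv_mulFunctional rfl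

theorem commute_dirDeriv_halfEuler (v : Euc m) : Commute (dirDeriv (v, (0 : ℝ))) (halfEuler m) :=
  ((commute_dirDeriv_mulL v).mul_right (dirDeriv_comm _ _)).smul_right _

theorem commute_evenLaplacian {T : Module.End ℝ (SmoothFun (Euc m × ℝ))}
    (h : ∀ v : Euc m, Commute (dirDeriv (v, (0 : ℝ))) T) : Commute (evenLaplacian m) T :=
  Commute.sum_left _ _ _ fun _ _ => (h _).mul_left (h _)

theorem halfEuler_mul_mulLSq : halfEuler m * mulLSq m = mulLSq m * (halfEuler m + 1) := by
  have h : dirDeriv ((0 : Euc m), (1 : ℝ)) * mulL m = mulL m * dirDeriv (0, 1) + 1 := by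
    rw [mulL, dirDeriv_mul_mulFunctional]
    simp
  rw [halfEuler, mulLSq, smul_mul_assoc, mul_assoc, ← mul_assoc (dirDeriv _), h, add_mul, mul_assoc,
    h]
  simp only [mul_add, mul_one, one_mul, mul_smul_comm, mul_assoc]
  module

/-- The function `h(x + L y)` of `(x, L, y)`. -/
def shiftFun (h : SmoothFun (Euc m)) : SmoothFun ((Euc m × ℝ) × Euc m) :=
  ⟨fun z => h (z.1.1 + z.1.2 • z.2), h.contDiff.comp (by fun_prop)⟩

theorem dirDeriv_shiftFun_apply (h : SmoothFun (Euc m)) (a b : Euc m) (l : ℝ)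
    (z : (Euc m × ℝ) × Euc m) :
    dirDeriv ((a, l), b) (shiftFun h) z =
      fderiv ℝ h (z.1.1 + z.1.2 • z.2) (a + (z.1.2 • b + l • z.2)) := by
  have h1 := (hasFDerivAt_fst (𝕜 := ℝ) (p := z)).fst.add
    ((hasFDerivAt_fst (𝕜 := ℝ) (p := z)).snd.smul (hasFDerivAt_snd (𝕜 := ℝ) (p := z)))
  have h2 := (h.differentiable (z.1.1 + z.1.2 • z.2)).hasFDerivAt.comp z h1
  exact (congrArg (fun T => T ((a, l), b)) h2.fderiv).trans rfl

/-- Multiplication by `L` of functions of `(x, L, y)`. -/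
def mulL' (m : ℕ) : Module.End ℝ (SmoothFun ((Euc m × ℝ) × Euc m)) :=
  mulFunctional ((ContinuousLinearMap.snd ℝ _ _).comp (ContinuousLinearMap.fst ℝ _ _))

/-- The operator `(1/2) L ∂/∂L` on functions of `(x, L, y)`. -/
def halfEuler' (m : ℕ) : Module.End ℝ (SmoothFun ((Euc m × ℝ) × Euc m)) :=
  (1 / 2 : ℝ) • (mulL' m * dirDeriv ((0, 1), 0))

theorem sphereAverage_halfEuler' (H : SmoothFun ((Euc m × ℝ) × Euc m)) :
    sphereAverage (halfEuler' m H) = halfEuler m (sphereAverage H) := by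
  change sphereAverage ((1 / 2 : ℝ) • mulL' m (dirDeriv ((0, 1), 0) H)) =
    (1 / 2 : ℝ) • mulL m (dirDeriv (0, 1) (sphereAverage H))
  rw [map_smul, mulL', sphereAverage_mulFunctional, sphereAverage_dirDeriv, mulL]

theorem derivY_shiftFun (h : SmoothFun (Euc m)) (i : Fin m) :
    derivY i (shiftFun h) = mulL' m (dirDeriv ((stdVec i, 0), 0) (shiftFun h)) := by
  refine SmoothFun.ext fun z => ?_
  rw [derivY, ← Prod.mk_zero_zero, mulL', mulFunctional_apply, dirDeriv_shiftFun_apply,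
    dirDeriv_shiftFun_apply]
  simp

theorem eulerY_shiftFun (h : SmoothFun (Euc m)) :
    eulerY m (shiftFun h) = (2 : ℝ) • halfEuler' m (shiftFun h) := by
  refine SmoothFun.ext fun z => ?_
  have h1 : (eulerY m (shiftFun h)) z = ∑ i, coord i z.2 * derivY i (shiftFun h) z := by
    rw [eulerY, LinearMap.sum_apply, SmoothFun.sum_apply]
    rfl
  have h2 : ((2 : ℝ) • halfEuler' m (shiftFun h)) z =
      2 * (1 / 2 * (z.1.2 * dirDeriv ((0, 1), 0) (shiftFun h) z)) := rfl
  rw [h1, h2, dirDeriv_shiftFun_apply]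
  simp only [derivY_shiftFun, mulL', mulFunctional_apply, dirDeriv_shiftFun_apply]
  have h3 (T : Euc m →L[ℝ] ℝ) : T z.2 = ∑ i, coord i z.2 * T (stdVec i) := by
    conv_lhs => rw [← sum_coord_smul_stdVec z.2, map_sum]
    simp
  simp only [smul_zero, zero_smul, add_zero, zero_add, one_smul]
  rw [h3 (fderiv ℝ h (z.1.1 + z.1.2 • z.2)), Finset.mul_sum, Finset.mul_sum, Finset.mul_sum]
  refine Finset.sum_congr rfl fun i _ => ?_
  change coord i z.2 * (z.1.2 * _) = _
  ring

theorem commute_derivY_mulL' (i : Fin m) : Commute (derivY i) (mulL' m) :=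
  commute_dirDeriv_mulFunctional rfl

theorem commute_eulerY_halfEuler' : Commute (eulerY m) (halfEuler' m) := by
  refine Commute.sum_left _ _ _ fun i _ => (Commute.mul_left ?_ ?_).smul_right _
  · refine Commute.mul_right (mulFunctional_comm _ _) ?_
    exact (commute_dirDeriv_mulFunctional (by simp)).symm
  · exact (commute_derivY_mulL' i).mul_right (dirDeriv_comm _ _)

/-- The basic spherical mean `∫_{𝕊^{m-1}} h(x + L y)` of a function on `ℝ^m`. -/
def evenMean (h : SmoothFun (Euc m)) : SmoothFun (Euc m × ℝ) := sphereAverage (shiftFun h)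

/-- The Darboux equation for functions on `ℝ^m`. -/
theorem evenMean_darboux (h : SmoothFun (Euc m)) :
    mulLSq m (evenLaplacian m (evenMean h)) =
      (4 : ℝ) • halfEuler m ((algebraMap ℝ _ ((m : ℝ) / 2 - 1) + halfEuler m) (evenMean h)) := by
  -- On h(x + Ly) one has ∂_{y_i} = L ∂_{x_i}, so L²Δ_x is Δ_y.
  have h1 : mulLSq m (evenLaplacian m (evenMean h)) =
      sphereAverage ((∑ j : Fin m, derivY j * derivY j) (shiftFun h)) := by
    simp only [evenLaplacian, LinearMap.sum_apply, map_sum, Module.End.mul_apply, mulLSq, evenMean,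
      derivY_shiftFun]
    refine Finset.sum_congr rfl fun i _ => ?_
    have h2 : derivY i (mulL' m (dirDeriv ((stdVec i, 0), 0) (shiftFun h))) =
        mulL' m (mulL' m (dirDeriv ((stdVec i, 0), 0) (dirDeriv ((stdVec i, 0), 0)
          (shiftFun h)))) := by
      have h3 : Commute (dirDeriv ((stdVec i, (0 : ℝ)), (0 : Euc m))) (mulL' m) :=
        commute_dirDeriv_mulFunctional rfl
      have h4 : Commute (derivY i) (dirDeriv ((stdVec i, (0 : ℝ)), (0 : Euc m))) :=
        dirDeriv_comm _ _
      rw [← Module.End.mul_apply, (commute_derivY_mulL' i).eq, Module.End.mul_apply,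
        ← Module.End.mul_apply (derivY i), h4.eq, Module.End.mul_apply, derivY_shiftFun,
        ← Module.End.mul_apply _ (mulL' m), h3.eq, Module.End.mul_apply]
    rw [h2, mulL', sphereAverage_mulFunctional, sphereAverage_mulFunctional,
      sphereAverage_dirDeriv, sphereAverage_dirDeriv]
    rfl
  rw [h1, sphereAverage_euler, evenMean]
  -- The Euler operator acts as 2X on `shiftFun h`; commutation with `halfEuler'` makes the second
  -- application act on `shiftFun h` as well.
  have h5 : (eulerY m * (eulerY m + ((m : ℝ) - 2) • 1)) (shiftFun h) =
      (4 : ℝ) • halfEuler' m (halfEuler' m (shiftFun h)) +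
        (2 * ((m : ℝ) - 2)) • halfEuler' m (shiftFun h) := by
    rw [Module.End.mul_apply, LinearMap.add_apply, eulerY_shiftFun, LinearMap.smul_apply,
      Module.End.one_apply, map_add, map_smul, map_smul, ← Module.End.mul_apply,
      commute_eulerY_halfEuler'.eq, Module.End.mul_apply, eulerY_shiftFun, map_smul]
    module
  rw [h5, map_add, map_smul, map_smul, sphereAverage_halfEuler', sphereAverage_halfEuler',
    LinearMap.add_apply, map_add, Module.algebraMap_end_apply, map_smul]
  module

/-- The operator `∏_{i<k} ((1/2) L ∂/∂L + m/2 - 1 - i)`. -/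
def shiftedFalling (m k : ℕ) : Module.End ℝ (SmoothFun (Euc m × ℝ)) :=
  fallingPow k (algebraMap ℝ _ ((m : ℝ) / 2 - 1) + halfEuler m)

theorem shiftedFalling_succ (k : ℕ) : shiftedFalling m (k + 1) =
    (algebraMap ℝ _ ((m : ℝ) / 2 - 1) + halfEuler m - k) * shiftedFalling m k :=
  fallingPow_succ _ _

/-- Moving the new factor s - k + X past L² turns X into X - 1, which is precisely the next factor s
- (k+1) + X. -/
theorem shiftedFalling_darboux (h : SmoothFun (Euc m)) (k : ℕ) :
    mulLSq m (evenLaplacian m (shiftedFalling m k (evenMean h))) =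
      (4 : ℝ) • halfEuler m (shiftedFalling m (k + 1) (evenMean h)) := by
  induction k with
  | zero =>
    rw [shiftedFalling_succ, shiftedFalling, fallingPow_zero, mul_one, Nat.cast_zero, sub_zero]
    exact evenMean_darboux h
  | succ k ih =>
    have hX : ∀ s, halfEuler m (mulLSq m s) = mulLSq m (halfEuler m s) + mulLSq m s := fun s => by
      rw [← Module.End.mul_apply, halfEuler_mul_mulLSq, Module.End.mul_apply, LinearMap.add_apply,
        map_add, Module.End.one_apply]
    have hΔ : ∀ s, evenLaplacian m (halfEuler m s) = halfEuler m (evenLaplacian m s) := fun s => by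
      rw [← Module.End.mul_apply, (commute_evenLaplacian commute_dirDeriv_halfEuler).eq,
        Module.End.mul_apply]
    have hstep : ∀ (k : ℕ) s, (algebraMap ℝ _ ((m : ℝ) / 2 - 1) + halfEuler m - (k : Module.End ℝ
        (SmoothFun (Euc m × ℝ)))) s = ((m : ℝ) / 2 - 1 - k) • s + halfEuler m s := fun k s => by
      rw [LinearMap.sub_apply, LinearMap.add_apply, Module.algebraMap_end_apply,
        Module.End.natCast_apply, ← Nat.cast_smul_eq_nsmul ℝ]
      module
    set t := shiftedFalling m k (evenMean h)
    have h1 : shiftedFalling m (k + 1) (evenMean h) =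
        ((m : ℝ) / 2 - 1 - k) • t + halfEuler m t := by
      rw [shiftedFalling_succ, Module.End.mul_apply, hstep]
    have h2 : shiftedFalling m (k + 1 + 1) (evenMean h) =
        ((m : ℝ) / 2 - 1 - (k + 1 : ℕ)) • shiftedFalling m (k + 1) (evenMean h) +
          halfEuler m (shiftedFalling m (k + 1) (evenMean h)) := by
      rw [shiftedFalling_succ, Module.End.mul_apply, hstep]
    have h3 : mulLSq m (halfEuler m (evenLaplacian m t)) =
        halfEuler m (mulLSq m (evenLaplacian m t)) - mulLSq m (evenLaplacian m t) := by
      rw [hX]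
      abel
    rw [h2, h1, map_add, map_add, map_smul, map_smul, hΔ, h3, ih, ← h1]
    simp only [map_add, map_smul]
    push_cast
    module

end Darboux

/-! ### Coefficientwise operators on arbitrary expansions -/

section Bosonic

variable {κ ι : Type} [Fintype κ] [LinearOrder κ]

theorem sum_coeff_smul (a : Grassmann κ) : ∑ A, coeff A a • monomials κ A = a :=
  (monomials κ).sum_repr a

theorem coeff_sum_smul (I : Finset ι) (c : ι → ℝ) (w : ι → Grassmann κ) (A : Finset κ) :
    coeff A (∑ i ∈ I, c i • w i) = ∑ i ∈ I, c i * coeff A (w i) := by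
  simp [coeff, Finsupp.finsetSum_apply]

theorem sum_smul_monomials (I : Finset ι) (c : ι → ℝ) (w : ι → Grassmann κ) :
    ∑ A, (∑ i ∈ I, c i * coeff A (w i)) • monomials κ A = ∑ i ∈ I, c i • w i := by
  simp only [← coeff_sum_smul, sum_coeff_smul]

/-- The w_i need not be monomials, nor linearly independent. -/
theorem bosonic_eq_sum {E E' : Type} {T : (E → ℝ) → E' → ℝ} {F : E → Grassmann κ} {p : E'}
    (I : Finset ι) (c : ι → ℝ) (w : ι → Grassmann κ)
    (h : ∀ A, T (fun q => coeff A (F q)) p = ∑ i ∈ I, c i * coeff A (w i)) :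
    bosonic T F p = ∑ i ∈ I, c i • w i := by
  simp only [bosonic, h, sum_smul_monomials]

end Bosonic

/-! ### Iterated radial derivatives -/

section Radial

variable {m : ℕ} {κ ι : Type} [Fintype κ] [LinearOrder κ]

/-- The operator `(1/2) ∑_i y_i ∂/∂y_i`. -/
def halfRadial (m : ℕ) : Module.End ℝ (SmoothFun (Euc m)) where
  toFun s := ⟨fun y => 1 / 2 * fderiv ℝ s y y, contDiff_const.mul
    ((s.contDiff.fderiv_right (m := ∞) (by simp)).clm_apply contDiff_id)⟩
  map_add' s t := SmoothFun.ext fun y => by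
    change 1 / 2 * dirDeriv y (s + t) y = 1 / 2 * dirDeriv y s y + 1 / 2 * dirDeriv y t y
    rw [map_add, ← mul_add]
    rfl
  map_smul' c s := SmoothFun.ext fun y => by
    change 1 / 2 * dirDeriv y (c • s) y = c * (1 / 2 * dirDeriv y s y)
    rw [map_smul, mul_left_comm]
    rfl

theorem halfRadial_apply (s : SmoothFun (Euc m)) (y : Euc m) :
    halfRadial m s y = 1 / 2 * fderiv ℝ s y y := rfl

/-- ∂/∂r² is r^{-2} times `halfRadial`, which has eigenvalue -j on r^{-2j}; so the step from j to j
+ 1 contributes the factor `halfRadial` - j. -/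
theorem iterate_bosonic_radialSqDeriv (I : Finset ι) (g : ι → SmoothFun (Euc m))
    (w : ι → Grassmann κ) (j : ℕ) {y : Euc m} (hy : y ≠ 0) :
    (bosonic radialSqDeriv)^[j] (fun y => ∑ i ∈ I, g i y • w i) y =
      ∑ i ∈ I, (((‖y‖ ^ 2) ^ j)⁻¹ * fallingPow j (halfRadial m) (g i) y) • w i := by
  induction j generalizing y with
  | zero => simp [fallingPow_zero]
  | succ j ih =>
    rw [Function.iterate_succ_apply']
    refine bosonic_eq_sum I _ w fun A => ?_
    -- The formula holds only off the origin, an open set, which is enough to differentiate it at y.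
    have hev : (fun q => coeff A ((bosonic radialSqDeriv)^[j] (fun y => ∑ i ∈ I, g i y • w i) q))
        =ᶠ[nhds y] fun q => ∑ i ∈ I,
          (((‖q‖ ^ 2) ^ j)⁻¹ * fallingPow j (halfRadial m) (g i) q) * coeff A (w i) := by
      filter_upwards [isOpen_ne.mem_nhds hy] with q hq
      rw [ih hq, coeff_sum_smul]
    have hn : ‖y‖ ^ 2 ≠ 0 := by simpa using hy
    have hinv : HasFDerivAt (fun q : Euc m => ((‖q‖ ^ 2) ^ j)⁻¹) _ y :=
      (hasDerivAt_inv (pow_ne_zero j hn)).comp_hasFDerivAt y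
        ((hasStrictFDerivAt_norm_sq y).hasFDerivAt.pow j)
    have hterm (i : ι) := ((hinv.mul
      ((fallingPow j (halfRadial m) (g i)).differentiable y).hasFDerivAt).mul_const
        (coeff A (w i)))
    have hsum := HasFDerivAt.fun_sum fun i (_ : i ∈ I) => hterm i
    rw [radialSqDeriv, hev.fderiv_eq]
    refine (congrArg (fun T : Euc m →L[ℝ] ℝ => T y / (2 * ‖y‖ ^ 2)) hsum.fderiv).trans ?_
    rw [sum_apply, Finset.sum_div]
    refine Finset.sum_congr rfl fun i _ => ?_
    have hf : fallingPow (j + 1) (halfRadial m) (g i) y =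
        1 / 2 * fderiv ℝ (fallingPow j (halfRadial m) (g i)) y y -
          j * fallingPow j (halfRadial m) (g i) y := by
      rw [fallingPow_succ, Module.End.mul_apply, LinearMap.sub_apply, Module.End.natCast_apply,
        ← Nat.cast_smul_eq_nsmul ℝ]
      rfl
    rw [hf]
    simp only [smul_apply, add_apply, smul_eq_mul,
      innerSL_apply_apply, real_inner_self_eq_norm_sq, nsmul_eq_mul]
    generalize ‖y‖ ^ 2 = r at hn
    rcases j with _ | j
    · simp only [pow_zero, Nat.cast_zero, zero_mul, mul_zero, add_zero, sub_zero, inv_one, zero_add,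
        pow_one]
      field_simp
    · rw [Nat.add_sub_cancel]
      push_cast
      field_simp
      ring

end Radial

/-! ### From radial derivatives in y to derivatives in L -/

section Slice

variable {m : ℕ}

/-- The function `y ↦ H(p, y)`. -/
def slice (p : Euc m × ℝ) : SmoothFun ((Euc m × ℝ) × Euc m) →ₗ[ℝ] SmoothFun (Euc m) where
  toFun H := ⟨fun y => H (p, y), H.contDiff.comp (contDiff_const.prodMk contDiff_id)⟩
  map_add' _ _ := rfl
  map_smul' _ _ := rfl

theorem slice_apply (p : Euc m × ℝ) (H : SmoothFun ((Euc m × ℝ) × Euc m)) (y : Euc m) :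
    slice p H y = H (p, y) := rfl

theorem slice_eulerY (p : Euc m × ℝ) (H : SmoothFun ((Euc m × ℝ) × Euc m)) :
    slice p (((1 / 2 : ℝ) • eulerY m) H) = halfRadial m (slice p H) := by
  refine SmoothFun.ext fun y => ?_
  have h1 : slice p (((1 / 2 : ℝ) • eulerY m) H) y =
      1 / 2 * ∑ i, coord i y * fderiv ℝ H (p, y) (0, stdVec i) := by
    change 1 / 2 * (eulerY m H) (p, y) = _
    rw [eulerY, LinearMap.sum_apply, SmoothFun.sum_apply]
    rfl
  have hd : HasFDerivAt (slice p H) ((fderiv ℝ H (p, y)).comp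
      (ContinuousLinearMap.inr ℝ _ _)) y :=
    (H.differentiable (p, y)).hasFDerivAt.comp y (hasFDerivAt_prodMk_right p y)
  rw [h1, halfRadial_apply, hd.fderiv]
  conv_rhs => rw [← sum_coord_smul_stdVec y, map_sum]
  simp only [sum_coord_smul_stdVec, map_smul, smul_eq_mul]
  rfl

/-- For fixed x, h(x + Ly) depends on L and y only through Ly, so both Euler operators act alike. -/
theorem fallingPow_halfRadial_slice (h : SmoothFun (Euc m)) (p : Euc m × ℝ) (j : ℕ) (y : Euc m) :
    fallingPow j (halfRadial m) (slice p (shiftFun h)) y =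
      fallingPow j (halfEuler' m) (shiftFun h) (p, y) := by
  rw [← fallingPow_intertwine (slice p) (slice_eulerY p), slice_apply,
    fallingPow_apply_congr (commute_eulerY_halfEuler'.smul_left _)]
  rw [LinearMap.smul_apply, eulerY_shiftFun]
  module

theorem integral_fallingPow_halfRadial (h : SmoothFun (Euc m)) (p : Euc m × ℝ) (j : ℕ) :
    ∫ v : Metric.sphere (0 : Euc m) 1, fallingPow j (halfRadial m) (slice p (shiftFun h)) v
      ∂(MeasureTheory.volume : MeasureTheory.Measure (Euc m)).toSphere =
      fallingPow j (halfEuler m) (evenMean h) p := by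
  simp only [fallingPow_halfRadial_slice]
  rw [evenMean, ← fallingPow_intertwine sphereAverage sphereAverage_halfEuler']
  rfl

end Slice

/-! ### Expansion of the super spherical mean -/

section Mean

open MeasureTheory

variable {m n : ℕ} {κ ι : Type} [Fintype κ] [LinearOrder κ]

theorem sphereIntegral_sum_smul {F : Euc m → Grassmann κ} (I : Finset ι)
    (c : ι → SmoothFun (Euc m)) (w : ι → Grassmann κ)
    (hF : ∀ v : Metric.sphere (0 : Euc m) 1, F v = ∑ i ∈ I, c i v • w i) :
    sphereIntegral F = ∑ i ∈ I, (∫ v : Metric.sphere (0 : Euc m) 1, c i v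
      ∂(volume : Measure (Euc m)).toSphere) • w i := by
  rw [sphereIntegral, ← sum_smul_monomials I]
  refine Finset.sum_congr rfl fun A _ => ?_
  congr 1
  simp only [hF, coeff_sum_smul]
  rw [integral_finsetSum]
  · simp only [integral_mul_const]
  · intro i _
    refine integrable_sphere_of_continuous _ ?_
    exact ((c i).contDiff.continuous.comp continuous_subtype_val).mul continuous_const

/-- The coefficient with index `A` of a superfunction, as a smooth function. -/
def coeffFun (f : Euc m → Grassmann κ) (hf : IsSuperfunction f) (A : Finset κ) :
    SmoothFun (Euc m) := ⟨fun x => coeff A (f x), hf A⟩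

theorem superShift_eq (f : Euc m → Grassmann (Fin (2 * n))) (hf : IsSuperfunction f)
    (p : Euc m × ℝ) : superShift f p.1 p.2 = fun y => ∑ A, slice p (shiftFun (coeffFun f hf A)) y •
      ExteriorAlgebra.map (oddShift (2 * n) p.2) (monomials _ A) := by
  funext y
  rw [superShift, ← sum_coeff_smul (f (p.1 + p.2 • y)), map_sum]
  simp only [map_smul]
  rfl

/-- The coefficient `(-1)^(i+j) s (s-1) ⋯ (s-i+1) / (i! j!)` with `s = m/2 - 1`. -/
def meanCoeff (m i j : ℕ) : ℝ :=
  (∏ l ∈ Finset.range i, ((m : ℝ) / 2 - 1 - l)) / i.factorial * (-1) ^ i *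
    ((-1) ^ j / j.factorial)

theorem neg_pow_eq_smul {R : Type*} [Ring R] [Algebra ℝ R] (t : R) (i : ℕ) :
    (-t) ^ i = (-1 : ℝ) ^ i • t ^ i := by
  rw [← neg_one_smul ℝ t, smul_pow]

theorem berezin_phiSharp_superShift (f : Euc m → Grassmann (Fin (2 * n))) (hf : IsSuperfunction f)
    (p : Euc m × ℝ) (v : Metric.sphere (0 : Euc m) 1) :
    berezin (oneSubThetaSqPow (Fin (2 * n)) n ((m : ℝ) / 2 - 1) *
      phiSharp (superShift f p.1 p.2) (v : Euc m)) =
      ∑ z ∈ Finset.univ ×ˢ (Finset.range (n + 1) ×ˢ Finset.range (n + 1)),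
        fallingPow z.2.2 (halfRadial m) (slice p (shiftFun (coeffFun f hf z.1))) v •
          meanCoeff m z.2.1 z.2.2 • berezinMoment n (z.2.1 + z.2.2) p.2 (monomials _ z.1) := by
  have hv : (v : Euc m) ≠ 0 := ne_zero_of_mem_unit_sphere v
  rw [berezin_eq, oneSubThetaSqPow, phiSharp, superShift_eq f hf, Finset.sum_mul_sum]
  simp only [iterate_bosonic_radialSqDeriv _ _ _ _ hv, norm_eq_of_mem_sphere, one_pow, inv_one,
    one_mul, Finset.mul_sum, Finset.smul_sum, map_sum, Finset.sum_product]
  symm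
  rw [Finset.sum_comm]
  refine Finset.sum_congr rfl fun i _ => ?_
  rw [Finset.sum_comm]
  refine Finset.sum_congr rfl fun j _ => Finset.sum_congr rfl fun A _ => ?_
  rw [meanCoeff, berezinMoment_apply, neg_pow_eq_smul (thetaSq (Fin (2 * n)) n)]
  simp only [mul_smul_comm, smul_mul_assoc, map_smul, smul_smul, ← mul_assoc, ← pow_add]
  congr 1
  ring

theorem sphericalMean_eq_sum (f : Euc m → Grassmann (Fin (2 * n))) (hf : IsSuperfunction f)
    (p : Euc m × ℝ) : sphericalMean f p =
      ∑ z ∈ Finset.univ ×ˢ (Finset.range (n + 1) ×ˢ Finset.range (n + 1)),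
        fallingPow z.2.2 (halfEuler m) (evenMean (coeffFun f hf z.1)) p •
          meanCoeff m z.2.1 z.2.2 • berezinMoment n (z.2.1 + z.2.2) p.2 (monomials _ z.1) := by
  rw [sphericalMean, supersphereIntegral]
  rw [sphereIntegral_sum_smul _ (fun z : Finset (Fin (2 * n)) × ℕ × ℕ =>
    fallingPow z.2.2 (halfRadial m) (slice p (shiftFun (coeffFun f hf z.1)))) _
    (berezin_phiSharp_superShift f hf p)]
  simp only [integral_fallingPow_halfRadial]

theorem sum_range_mul_eq_sum_antidiagonal {M : Type*} [AddCommMonoid M] (n : ℕ) (g : ℕ × ℕ → M)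
    (hg : ∀ z : ℕ × ℕ, n < z.1 + z.2 → g z = 0) :
    ∑ z ∈ Finset.range (n + 1) ×ˢ Finset.range (n + 1), g z =
      ∑ k ∈ Finset.range (n + 1), ∑ z ∈ Finset.HasAntidiagonal.antidiagonal k, g z := by
  rw [Finset.sum_sigma']
  symm
  refine Finset.sum_bij_ne_zero (fun x _ _ => x.2) ?_ ?_ ?_ ?_
  · rintro ⟨k, z⟩ h _
    simp only [Finset.mem_sigma, Finset.mem_range, Finset.HasAntidiagonal.mem_antidiagonal,
      Finset.mem_product] at h ⊢
    omega
  · rintro ⟨k, z⟩ h _ ⟨k', z'⟩ h' _ (rfl : z = z')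
    simp only [Finset.mem_sigma, Finset.HasAntidiagonal.mem_antidiagonal] at h h'
    obtain rfl : k = k' := h.2.symm.trans h'.2
    rfl
  · intro z _ hz
    refine ⟨⟨z.1 + z.2, z⟩, ?_, hz, rfl⟩
    simp only [Finset.mem_sigma, Finset.mem_range, Finset.HasAntidiagonal.mem_antidiagonal, and_true]
    by_contra h
    exact hz (hg z (by omega))
  · intros
    rfl

/-- Chu-Vandermonde for the scalar m/2 - 1 and X, after division by k!. -/
theorem sum_antidiagonal_meanCoeff (k : ℕ) (u : SmoothFun (Euc m × ℝ)) (p : Euc m × ℝ) :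
    ∑ z ∈ Finset.HasAntidiagonal.antidiagonal k,
      fallingPow z.2 (halfEuler m) u p * meanCoeff m z.1 z.2 =
      (-1) ^ k / k.factorial * shiftedFalling m k u p := by
  rw [shiftedFalling, fallingPow_add k (Algebra.commutes _ _), LinearMap.sum_apply,
    SmoothFun.sum_apply, Finset.mul_sum]
  refine Finset.sum_congr rfl fun z hz => ?_
  have hk : z.1 + z.2 = k := Finset.HasAntidiagonal.mem_antidiagonal.1 hz
  rw [fallingPow_algebraMap]
  have h : (((k.choose z.1 : ℕ) : Module.End ℝ (SmoothFun (Euc m × ℝ))) *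
      (algebraMap ℝ _ (∏ i ∈ Finset.range z.1, ((m : ℝ) / 2 - 1 - i)) *
        fallingPow z.2 (halfEuler m))) u p =
      (k.choose z.1 : ℝ) * ((∏ i ∈ Finset.range z.1, ((m : ℝ) / 2 - 1 - i)) *
        fallingPow z.2 (halfEuler m) u p) := by
    rw [Module.End.mul_apply, Module.End.mul_apply, Module.End.natCast_apply,
      ← Nat.cast_smul_eq_nsmul ℝ, Module.algebraMap_end_apply]
    rfl
  rw [h, meanCoeff, ← hk, Nat.cast_add_choose, pow_add]
  have h1 : (z.1.factorial : ℝ) ≠ 0 := by positivity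
  have h2 : (z.2.factorial : ℝ) ≠ 0 := by positivity
  have h3 : ((z.1 + z.2).factorial : ℝ) ≠ 0 := by positivity
  field_simp

/-- The coefficient functions of the Pizzetti-type expansion of the super spherical mean. -/
def meanTerm (n : ℕ) (h : SmoothFun (Euc m)) (q : ℕ) : SmoothFun (Euc m × ℝ) :=
  ((-1 : ℝ) ^ n / (n.factorial * (4 ^ q * q.factorial))) •
    (mulLSq m ^ q) (shiftedFalling m (n - q) (evenMean h))

theorem mulLSq_pow_apply (q : ℕ) (s : SmoothFun (Euc m × ℝ)) (p : Euc m × ℝ) :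
    (mulLSq m ^ q) s p = (p.2 ^ 2) ^ q * s p := by
  induction q generalizing s with
  | zero => simp
  | succ q ih =>
    rw [pow_succ, Module.End.mul_apply, ih, pow_succ (p.2 ^ 2), mul_assoc]
    congr 1
    change p.2 * (p.2 * s p) = _
    ring

theorem sphericalMean_eq_sum_meanTerm (f : Euc m → Grassmann (Fin (2 * n)))
    (hf : IsSuperfunction f) (p : Euc m × ℝ) : sphericalMean f p =
      ∑ z ∈ Finset.univ ×ˢ Finset.range (n + 1), meanTerm n (coeffFun f hf z.1) z.2 p •
        topMoment n ((oddLaplacian n ^ z.2) (monomials _ z.1)) := by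
  rw [sphericalMean_eq_sum f hf, Finset.sum_product, Finset.sum_product]
  refine Finset.sum_congr rfl fun A _ => ?_
  rw [sum_range_mul_eq_sum_antidiagonal n (fun z : ℕ × ℕ =>
    fallingPow z.2 (halfEuler m) (evenMean (coeffFun f hf A)) p •
      meanCoeff m z.1 z.2 • berezinMoment n (z.1 + z.2) p.2 (monomials _ A))
    fun z hz => by rw [berezinMoment_eq_zero hz, LinearMap.zero_apply, smul_zero, smul_zero]]
  have h (k : ℕ) : ∑ z ∈ Finset.HasAntidiagonal.antidiagonal k,
      fallingPow z.2 (halfEuler m) (evenMean (coeffFun f hf A)) p •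
        meanCoeff m z.1 z.2 • berezinMoment n (z.1 + z.2) p.2 (monomials _ A) =
      ((-1) ^ k / k.factorial * shiftedFalling m k (evenMean (coeffFun f hf A)) p) •
        berezinMoment n k p.2 (monomials _ A) := by
    rw [← sum_antidiagonal_meanCoeff, Finset.sum_smul]
    refine Finset.sum_congr rfl fun z hz => ?_
    rw [Finset.HasAntidiagonal.mem_antidiagonal.1 hz, smul_smul]
  simp only [h]
  -- Reindex by q = n - k, the power of L² supplied by the k-th Berezin moment.
  rw [← Finset.sum_range_reflect]
  refine Finset.sum_congr rfl fun q hq => ?_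
  have hq' : q ≤ n := Nat.lt_succ_iff.1 (Finset.mem_range.1 hq)
  have hm : meanTerm n (coeffFun f hf A) q p =
      (-1 : ℝ) ^ n / (n.factorial * (4 ^ q * q.factorial)) *
        ((p.2 ^ 2) ^ q * shiftedFalling m (n - q) (evenMean (coeffFun f hf A)) p) := by
    rw [← mulLSq_pow_apply]
    rfl
  rw [show n + 1 - 1 - q = n - q by omega, berezinMoment_sub hq', smul_smul, hm]
  congr 1
  have h1 : ((n - q).factorial : ℝ) ≠ 0 := by positivity
  have h2 : (n.factorial : ℝ) ≠ 0 := by positivity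
  have h3 : (q.factorial : ℝ) ≠ 0 := by positivity
  have h4 : (-1 : ℝ) ^ n = (-1) ^ (n - q) * (-1) ^ q := by
    rw [← pow_add, Nat.sub_add_cancel hq']
  rw [h4]
  field_simp

/-- Since X L^{2q} = L^{2q}(X + q), the right side is a constant times L^{2q} 4(X + q) S_{n+1-q} u.
Its X part is the even Laplacian term; its q part is the defect added on the left. -/
theorem mulLSq_evenLaplacian_meanTerm (h : SmoothFun (Euc m)) {q : ℕ} (hq : q ≤ n) :
    mulLSq m (evenLaplacian m (meanTerm n h q)) +
      ((-1 : ℝ) ^ n / (n.factorial * (4 ^ q * q.factorial)) * (4 * q)) •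
        (mulLSq m ^ q) (shiftedFalling m (n + 1 - q) (evenMean h)) =
      (4 : ℝ) • halfEuler m (halfEuler m (meanTerm n h q)) +
        (4 * ((m : ℝ) / 2 - 1 - n)) • halfEuler m (meanTerm n h q) := by
  have hX : ∀ (q : ℕ) s, halfEuler m ((mulLSq m ^ q) s) =
      (mulLSq m ^ q) (halfEuler m s) + (q : ℝ) • (mulLSq m ^ q) s := by
    intro q
    induction q with
    | zero => simp
    | succ q ih =>
      intro s
      have h1 (t) : halfEuler m (mulLSq m t) = mulLSq m (halfEuler m t) + mulLSq m t := by
        rw [← Module.End.mul_apply, halfEuler_mul_mulLSq, Module.End.mul_apply,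
          LinearMap.add_apply, map_add, Module.End.one_apply]
      rw [pow_succ', Module.End.mul_apply, h1, ih, Module.End.mul_apply, map_add, map_smul]
      push_cast
      module
  have hΔ (s) : mulLSq m (evenLaplacian m ((mulLSq m ^ q) s)) =
      (mulLSq m ^ q) (mulLSq m (evenLaplacian m s)) := by
    have hc : Commute (evenLaplacian m) (mulLSq m) := commute_evenLaplacian fun v =>
      (commute_dirDeriv_mulL v).mul_right (commute_dirDeriv_mulL v)
    rw [← Module.End.mul_apply (evenLaplacian m), (hc.pow_right q).eq, Module.End.mul_apply,
      ← Module.End.mul_apply, ← Module.End.mul_apply, ((Commute.refl (mulLSq m)).pow_right q).eq]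
    rfl
  set t := shiftedFalling m (n - q) (evenMean h) with ht
  have hs : shiftedFalling m (n + 1 - q) (evenMean h) =
      ((m : ℝ) / 2 - 1 - n + q) • t + halfEuler m t := by
    rw [show n + 1 - q = n - q + 1 by omega, shiftedFalling_succ, Module.End.mul_apply,
      LinearMap.sub_apply, LinearMap.add_apply, Module.algebraMap_end_apply,
      Module.End.natCast_apply, ← Nat.cast_smul_eq_nsmul ℝ, Nat.cast_sub hq]
    module
  have hd := shiftedFalling_darboux h (n - q)
  rw [show n - q + 1 = n + 1 - q by omega, hs, ← ht] at hd
  rw [meanTerm, hs, ← ht]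
  simp only [map_smul, hΔ, hd, hX, map_add]
  module

end Mean

/-! ### Differential operators on the expansion and the final cancellation -/

section Operators

variable {m n : ℕ} {ι : Type}

theorem isSuperfunction_sum {V κ : Type} [NormedAddCommGroup V] [NormedSpace ℝ V] [Fintype κ]
    [LinearOrder κ] (I : Finset ι) (s : ι → SmoothFun V) (w : ι → Grassmann κ) :
    IsSuperfunction fun p => ∑ i ∈ I, s i p • w i := by
  intro A
  simp only [coeff_sum_smul]
  exact ContDiff.sum fun i _ => (s i).contDiff.mul contDiff_const

theorem derivL_sum (I : Finset ι) (s : ι → SmoothFun (Euc m × ℝ))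
    (w : ι → Grassmann (Fin (2 * n))) :
    derivL (fun p => ∑ i ∈ I, s i p • w i) = fun p => ∑ i ∈ I, dirDeriv (0, 1) (s i) p • w i := by
  funext p
  refine bosonic_eq_sum I _ w fun A => ?_
  simp only [coeff_sum_smul]
  have h (i : ι) : HasDerivAt (fun l => s i (p.1, l)) (dirDeriv (0, 1) (s i) p) p.2 :=
    HasFDerivAt.comp_hasDerivAt (f := fun l : ℝ => (p.1, l)) p.2
      ((s i).differentiable p).hasFDerivAt ((hasDerivAt_const p.2 p.1).prodMk (hasDerivAt_id p.2))
  exact (HasDerivAt.fun_sum fun i _ => (h i).mul_const _).deriv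

theorem laplacian_slice (s : SmoothFun (Euc m × ℝ)) (p : Euc m × ℝ) :
    Laplacian.laplacian (fun x => s (x, p.2)) p.1 = evenLaplacian m s p := by
  have h (s : SmoothFun (Euc m × ℝ)) (x : Euc m) :
      HasFDerivAt (fun x => s (x, p.2)) ((fderiv ℝ s (x, p.2)).comp
        (ContinuousLinearMap.inl ℝ _ _)) x :=
    (s.differentiable (x, p.2)).hasFDerivAt.comp x (hasFDerivAt_prodMk_left x p.2)
  have hs : ContDiff ℝ ∞ fun x => s (x, p.2) := s.contDiff.comp (contDiff_id.prodMk contDiff_const)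
  rw [InnerProductSpace.laplacian_eq_iteratedFDeriv_orthonormalBasis _
    (EuclideanSpace.basisFun (Fin m) ℝ), evenLaplacian, LinearMap.sum_apply, SmoothFun.sum_apply]
  refine Finset.sum_congr rfl fun i _ => ?_
  rw [iteratedFDeriv_two_apply]
  have h2 := fderiv_clm_apply ((hs.fderiv_right (m := ∞) (by simp)).differentiable (by simp) p.1)
    (differentiableAt_const (stdVec i))
  have h3 : (fun x => fderiv ℝ (fun x => s (x, p.2)) x (stdVec i)) =
      fun x => dirDeriv (stdVec i, 0) s (x, p.2) := by
    funext x
    rw [(h s x).fderiv]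
    rfl
  rw [h3, (h _ p.1).fderiv] at h2
  have h4 := congrArg (fun T => T (stdVec i)) h2
  simp only [add_apply, ContinuousLinearMap.comp_apply, ContinuousLinearMap.flip_apply] at h4
  rw [fderiv_fun_const, Pi.zero_apply, zero_apply, map_zero, zero_add] at h4
  exact h4.symm

theorem superLaplacian_sum (I : Finset ι) (s : ι → SmoothFun (Euc m × ℝ))
    (w : ι → Grassmann (Fin (2 * n))) (p : Euc m × ℝ) :
    superLaplacian (fun x => ∑ i ∈ I, s i (x, p.2) • w i) p.1 =
      ∑ i ∈ I, evenLaplacian m (s i) p • w i + ∑ i ∈ I, s i p • oddLaplacian n (w i) := by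
  have h : bosonic (fun h => Laplacian.laplacian h) (fun x => ∑ i ∈ I, s i (x, p.2) • w i) p.1 =
      ∑ i ∈ I, evenLaplacian m (s i) p • w i := by
    refine bosonic_eq_sum I _ w fun A => ?_
    have h1 : (fun x : Euc m => coeff A (∑ i ∈ I, s i (x, p.2) • w i)) =
        fun x => (∑ i ∈ I, coeff A (w i) • s i) (x, p.2) := by
      funext x
      rw [coeff_sum_smul, SmoothFun.sum_apply]
      exact Finset.sum_congr rfl fun i _ => mul_comm _ _
    rw [h1, laplacian_slice, map_sum, SmoothFun.sum_apply]
    refine Finset.sum_congr rfl fun i _ => ?_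
    rw [map_smul]
    exact mul_comm _ _
  rw [superLaplacian, h, sub_eq_add_neg, ← neg_smul, ← oddLaplacian_apply, map_sum]
  simp only [map_smul]

theorem sum_meanTerm_darboux (f : Euc m → Grassmann (Fin (2 * n))) (hf : IsSuperfunction f)
    (p : Euc m × ℝ) (hp : p.2 ≠ 0) :
    superLaplacian (fun x => ∑ z ∈ Finset.univ ×ˢ Finset.range (n + 1),
        meanTerm n (coeffFun f hf z.1) z.2 (x, p.2) •
          topMoment n ((oddLaplacian n ^ z.2) (monomials _ z.1))) p.1
      - ∑ z ∈ Finset.univ ×ˢ Finset.range (n + 1),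
        dirDeriv (0, 1) (dirDeriv (0, 1) (meanTerm n (coeffFun f hf z.1) z.2)) p •
          topMoment n ((oddLaplacian n ^ z.2) (monomials _ z.1))
      - (((m : ℝ) - 2 * (n : ℝ) - 1) / p.2) • ∑ z ∈ Finset.univ ×ˢ Finset.range (n + 1),
        dirDeriv (0, 1) (meanTerm n (coeffFun f hf z.1) z.2) p •
          topMoment n ((oddLaplacian n ^ z.2) (monomials _ z.1)) = 0 := by
  rw [superLaplacian_sum]
  simp only [Finset.sum_product, Finset.smul_sum]
  rw [← Finset.sum_add_distrib, ← Finset.sum_sub_distrib, ← Finset.sum_sub_distrib]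
  refine Finset.sum_eq_zero fun A _ => ?_
  set s : ℕ → SmoothFun (Euc m × ℝ) := meanTerm n (coeffFun f hf A) with hs
  set w : ℕ → Grassmann (Fin (2 * n)) := fun q =>
    topMoment n ((oddLaplacian n ^ q) (monomials _ A)) with hw
  -- The defect of the q-th term: it vanishes for q = 0, and t (q+1) = L² s q, since 4(q+1) cancels
  -- the growth of the denominator.
  let t : ℕ → SmoothFun (Euc m × ℝ) := fun q =>
    ((-1 : ℝ) ^ n / (n.factorial * (4 ^ q * q.factorial)) * (4 * q)) •
      (mulLSq m ^ q) (shiftedFalling m (n + 1 - q) (evenMean (coeffFun f hf A)))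
  have hNw (q : ℕ) : oddLaplacian n (w q) = w (q + 1) := by
    simp only [hw]
    rw [← topMoment_oddLaplacian, pow_succ', Module.End.mul_apply]
  have hwn : w (n + 1) = 0 := topMoment_oddLaplacian_pow_succ _
  have ht0 : t 0 = 0 := by simp [t]
  have htsucc (q : ℕ) : t (q + 1) p = p.2 ^ 2 * s q p := by
    have h1 : t (q + 1) p = ((-1 : ℝ) ^ n / (n.factorial * (4 ^ (q + 1) * (q + 1).factorial)) *
        (4 * (q + 1 : ℕ))) * ((mulLSq m ^ (q + 1)) (shiftedFalling m (n + 1 - (q + 1))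
          (evenMean (coeffFun f hf A)))) p := rfl
    have h2 : s q p = ((-1 : ℝ) ^ n / (n.factorial * (4 ^ q * q.factorial))) *
        ((mulLSq m ^ q) (shiftedFalling m (n - q) (evenMean (coeffFun f hf A)))) p := rfl
    rw [h1, h2, mulLSq_pow_apply, mulLSq_pow_apply, Nat.factorial_succ, Nat.add_sub_add_right]
    push_cast
    have h3 : (n.factorial : ℝ) ≠ 0 := by positivity
    have h4 : (q.factorial : ℝ) ≠ 0 := by positivity
    have h5 : (q : ℝ) + 1 ≠ 0 := by positivity
    field_simp
    ring
  -- Index shift without boundary terms, as w (n+1) = 0 and t 0 = 0.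
  have hshift : ∑ q ∈ Finset.range (n + 1), (p.2 ^ 2 * s q p) • oddLaplacian n (w q) =
      ∑ q ∈ Finset.range (n + 1), t q p • w q := by
    have h1 := Finset.sum_range_succ' (fun q => t q p • w q) (n + 1)
    rw [Finset.sum_range_succ, hwn, smul_zero, add_zero, ht0] at h1
    have h0 : (0 : SmoothFun (Euc m × ℝ)) p = 0 := rfl
    rw [h1, h0, zero_smul, add_zero]
    simp only [hNw, htsucc]
  -- 4X² + 4(m/2 - 1 - n)X equals L²∂_L² + (m - 2n - 1) L∂_L.
  have hode (q : ℕ) (hq : q ∈ Finset.range (n + 1)) :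
      p.2 ^ 2 * evenLaplacian m (s q) p + t q p =
        p.2 ^ 2 * dirDeriv (0, 1) (dirDeriv (0, 1) (s q)) p +
          ((m : ℝ) - 2 * n - 1) * (p.2 * dirDeriv (0, 1) (s q) p) := by
    have h1 := congrArg (SmoothFun.eval p) (mulLSq_evenLaplacian_meanTerm (coeffFun f hf A)
      (Nat.lt_succ_iff.1 (Finset.mem_range.1 hq)))
    rw [map_add, map_add, map_smul _ (4 : ℝ), map_smul _ (4 * _ : ℝ)] at h1
    have hY (u : SmoothFun (Euc m × ℝ)) : SmoothFun.eval p (mulLSq m u) = p.2 ^ 2 * u p := by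
      rw [← pow_one (mulLSq m)]
      exact (mulLSq_pow_apply 1 u p).trans (by rw [pow_one])
    have hX (u : SmoothFun (Euc m × ℝ)) :
        SmoothFun.eval p (halfEuler m u) = 1 / 2 * (p.2 * dirDeriv (0, 1) u p) := rfl
    have hXX (u : SmoothFun (Euc m × ℝ)) : dirDeriv (0, 1) (halfEuler m u) p =
        1 / 2 * (p.2 * dirDeriv (0, 1) (dirDeriv (0, 1) u) p + dirDeriv (0, 1) u p) := by
      have h2 : dirDeriv (0, 1) (halfEuler m u) = (1 / 2 : ℝ) •
          (mulL m (dirDeriv (0, 1) (dirDeriv (0, 1) u)) + dirDeriv (0, 1) u) := by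
        rw [halfEuler, LinearMap.smul_apply, map_smul, Module.End.mul_apply,
          ← Module.End.mul_apply _ (mulL m), mulL, dirDeriv_mul_mulFunctional]
        simp
      rw [h2]
      rfl
    rw [hY, hX, hX, hXX, smul_eq_mul, smul_eq_mul] at h1
    refine Eq.trans h1 ?_
    ring
  refine (smul_eq_zero_iff_right (pow_ne_zero 2 hp)).1 ?_
  change p.2 ^ 2 • (∑ q ∈ Finset.range (n + 1), evenLaplacian m (s q) p • w q +
    ∑ q ∈ Finset.range (n + 1), s q p • oddLaplacian n (w q) -
    ∑ q ∈ Finset.range (n + 1), dirDeriv (0, 1) (dirDeriv (0, 1) (s q)) p • w q -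
    ∑ q ∈ Finset.range (n + 1),
      (((m : ℝ) - 2 * n - 1) / p.2) • dirDeriv (0, 1) (s q) p • w q) = 0
  have hfinal : ∑ q ∈ Finset.range (n + 1), (p.2 ^ 2 * evenLaplacian m (s q) p) • w q +
      ∑ q ∈ Finset.range (n + 1), (p.2 ^ 2 * s q p) • oddLaplacian n (w q) =
      ∑ q ∈ Finset.range (n + 1), (p.2 ^ 2 * dirDeriv (0, 1) (dirDeriv (0, 1) (s q)) p +
          ((m : ℝ) - 2 * n - 1) * (p.2 * dirDeriv (0, 1) (s q) p)) • w q := by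
    rw [hshift, ← Finset.sum_add_distrib]
    refine Finset.sum_congr rfl fun q hq => ?_
    rw [← hode q hq, add_smul]
  have hc : p.2 ^ 2 * (((m : ℝ) - 2 * n - 1) / p.2) = ((m : ℝ) - 2 * n - 1) * p.2 := by
    field_simp
  simp only [smul_sub, smul_add, Finset.smul_sum, smul_smul, ← mul_assoc, hc]
  simp only [add_smul, Finset.sum_add_distrib, ← mul_assoc] at hfinal
  rw [hfinal]
  abel

end Operators

end Superspace

end

theorem mainTheorem11 (m n : ℕ) (hm : 1 ≤ m)
    (f : EuclideanSpace ℝ (Fin m) → Superspace.Grassmann (Fin (2 * n)))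
    (hf : Superspace.IsSuperfunction f) :
    Superspace.IsSuperfunction (Superspace.sphericalMean f) ∧
    ∀ (x : EuclideanSpace ℝ (Fin m)) (L : ℝ), L ≠ 0 →
      Superspace.superLaplacian (fun x' => Superspace.sphericalMean f (x', L)) x
        - Superspace.derivL (Superspace.derivL (Superspace.sphericalMean f)) (x, L)
        - ((((m : ℝ) - 2 * (n : ℝ)) - 1) / L) •
            Superspace.derivL (Superspace.sphericalMean f) (x, L) = 0 := by
  open Superspace in
  have hmean : sphericalMean f = fun p =>
      ∑ z ∈ Finset.univ ×ˢ Finset.range (n + 1), meanTerm n (coeffFun f hf z.1) z.2 p •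
        topMoment n ((oddLaplacian n ^ z.2) (monomials _ z.1)) :=
    funext (sphericalMean_eq_sum_meanTerm f hf)
  rw [hmean]
  -- Smoothness extends across L = 0 because the expansion has smooth coefficient functions and
  -- Grassmann factors independent of L.
  refine ⟨isSuperfunction_sum _ _ _, fun x L hL => ?_⟩
  rw [derivL_sum, derivL_sum]
  exact sum_meanTerm_darboux f hf (x, L) hL
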